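/- Conventions. All powers and logarithms are principal; $\Gamma(s,z)=\int_z^\infty t^{s-1}e^{-t}\,dt$ is the principal branch of the upper incomplete gamma function (path of integration not crossing the cut $(-\infty,0]$, $\arg z\in(-\pi,\pi]$); $\Phi(z,s,\alpha)$ is the Hurwitz–Lerch zeta function, i.e. $\sum_{n\ge 0} z^n/(n+\alpha)^s$ for $|z|<1$, continued analytically in $z$ to $\mathbb C\setminus[1,\infty)$ (to $\mathbb C\setminus\{1\}$ whenever that is possible, in particular for $s=0,-1,-2,\dots$, when $\Phi$ is a rational function of $z$). **Theorem.** Let $a,k,m\in\mathbb C$ and $\beta\in\mathbb R$ with $0<\beta<2\pi$, $a\neq 0$, $m\notin\mathbb Z$, and $\operatorname{Re}k>-1$ in case $a=1$. Assume that one of the following holds: 1. ($k$ arbitrary) $\operatorname{Im} m>0$ and $\operatorname{Im} a\ge 0$; 2. $k\in\{0,1,2,\dots\}$; 3. $k\in\mathbb Z$, $m\notin\{p-it: p\in\mathbb Z,\ t\ge 0\}$, and for every $n\in\mathbb Z$ one has $-\pi<\arg_*(n-m)+\arg(\log a)\le\pi$, where $\arg_*(w)\in(-\tfrac{3\pi}2,\tfrac{\pi}2]$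 is the argument of $w$ with cut along the positive imaginary axis (for real $m$ and $a\ne1$ this says: $\operatorname{Im} a\ge 0$ and $a\notin(1,\infty)$). Then $$\sum_{n=-\infty}^{\infty}\frac{a^{\,n-m}\,e^{in\beta}\,\Gamma\bigl(1+k,(n-m)\log a\bigr)}{(n-m)^{k+1}} = i\,e^{\frac i2(k\pi+2m\beta)}\,(2\pi)^{1+k}\,\Phi\Bigl(e^{2\pi i m},-k,\frac{\beta-i\log a}{2\pi}\Bigr),$$ where the bilateral series converges in the sense that $\sum_{n=-M}^{N}$ tends to the right-hand side as $M,N\to\infty$ independently. -/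

import Mathlib

open Filter Topology MeasureTheory

/-- Direction of the ray used to integrate from `z` to infinity without crossing the negative real
axis: up-right if `0 ≤ Im z`, down-right if `Im z < 0`. -/
noncomputable def rayDir (z : ℂ) : ℂ :=
  if 0 ≤ z.im then 1 + Complex.I else 1 - Complex.I

/-- The principal branch of the upper incomplete gamma function,
`Γ(s, z) = ∫_z^∞ t ^ (s - 1) * exp (-t) dt`, along the ray `t = z + x * rayDir z`, `0 < x`.
This ray does not cross the cut `(-∞, 0]` and `t ^ (s - 1)` is the principal power; on the cut
the value is the limit from the upper half-plane (`arg z = π`).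
The integral converges absolutely for all `s` if `z ≠ 0`, and for `0 < Re s` if `z = 0`. -/
noncomputable def upperIncompleteGamma (s z : ℂ) : ℂ :=
  ∫ x in Set.Ioi (0 : ℝ),
    (z + x * rayDir z) ^ (s - 1) * Complex.exp (-(z + x * rayDir z)) * rayDir z

/-- The Hurwitz-Lerch series `∑_{n ≥ 0} z ^ n / (n + a) ^ s` (principal powers). -/
noncomputable def lerchSeries (z s a : ℂ) : ℂ :=
  ∑' n : ℕ, z ^ n / ((n : ℂ) + a) ^ s

/-- `F` is an analytic continuation in `z`, to the set `U`, of the Hurwitz-Lerch series on the open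
unit disc. -/
def IsLerchContinuation (U : Set ℂ) (s a : ℂ) (F : ℂ → ℂ) : Prop :=
  AnalyticOnNhd ℂ F U ∧ ∀ z : ℂ, ‖z‖ < 1 → F z = lerchSeries z s a

/-- The plane cut along `[1, ∞)`. -/
def lerchSlitPlane : Set ℂ := {z : ℂ | ¬ (z.im = 0 ∧ 1 ≤ z.re)}

open Classical in
/-- The Hurwitz-Lerch zeta function `Φ(z, s, a)`: the series in the open unit disc (and at `z = 1`),
elsewhere its analytic continuation in `z`. The continuation is to `ℂ \ {1}` whenever there is one
(as for `s = 0, -1, -2, …`, where `Φ` is rational in `z`), and otherwise to the plane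
cut along `[1, ∞)`. Both sets are connected, so the continuation is unique there. -/
noncomputable def lerchPhi (z s a : ℂ) : ℂ :=
  if ‖z‖ < 1 ∨ z = 1 then lerchSeries z s a
  else if h : ∃ F, IsLerchContinuation {1}ᶜ s a F then h.choose z
  else if h : ∃ F, IsLerchContinuation lerchSlitPlane s a F then h.choose z
  else 0

/-- The argument of `w` in `(-3π/2, π/2]`, i.e. with the cut along the positive imaginary axis. -/
noncomputable def argUp (w : ℂ) : ℝ := (Complex.I * w).arg - Real.pi / 2

/-- The `n`-th term `a^(n-m) e^{inβ} Γ(1+k, (n-m) log a) / (n-m)^(k+1)` of the bilateral series,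
all functions being principal branches. -/
noncomputable def bilateralTerm (a k m : ℂ) (β : ℝ) (n : ℤ) : ℂ :=
  a ^ ((n : ℂ) - m) * Complex.exp (Complex.I * n * β) *
    upperIncompleteGamma (1 + k) (((n : ℂ) - m) * Complex.log a) / ((n : ℂ) - m) ^ (k + 1)

/-! Put `w = n - m` and `L = log a`. Substituting `t ↦ w t` and turning the path of integration
shows that, when no branch cut is met, the `n`-th term is `e^{inβ} e^{wL} ∫ t^k e^{-wt} dt`, taken
along a ray from `L` in a direction `d` with `Re (w d) > 0`. The dependence on `n` is then purely
exponential, and the series can be summed.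

If `Im m > 0` and `Im a ≥ 0`, then `d = i` serves for all `n` at once. The term is a constant times
`∫_0^∞ f(y) e^{in(β-y)} dy` with `f(y) = (y - iL)^k e^{imy}`. Folding modulo `2π` turns it into a
Fourier coefficient of the periodization `G` of `f`. The Fourier series of `G` converges at `β` to
`2π G(β)` (`tendsto_sum_integral_mul_exp`), and `G(β)` is a Lerch series. This is Poisson summation
(`tendsto_sum_bilateralTerm_of_im_pos`).

If `k = j` is a natural number, the integral over `(0, ∞)` may diverge, but its folded form over
`(0, 2π]` survives: `G` is `e^{imy}` times a polynomial in `y` whose coefficients are rational in `z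
= e^{2πim}`. The representation follows by integrating by parts, using `Φ(z,-j,α) - z Φ(z,-j,α+1) =
α^j` (`exp_mul_upperIncompleteGamma_div_eq_integral`). Only `z ≠ 1` is needed.

If `k = -r` with `r ≥ 1` and `Im m ≤ 0`, one continues in `m` down a strip between consecutive
integers. The rays are tilted to `1 + iη` for large `n` and `-1 + iη` for small `n`. Each half of
the series is then geometric under the integral sign, and the sum is holomorphic in `m`. It equals
the right-hand side where `Im m > 0`, hence on the strip (`tendsto_sum_tilted_lerchPhi`). The
argument condition guarantees that the tilted integrals are still the principal incomplete gamma
values (`upperIncompleteGamma_mul_eq_rayIntegral_tiltedDir`). -/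

/-! ### Cauchy's theorem on an infinite wedge. -/

theorem tendsto_mul_rpow_mul_exp_nhdsGT_zero {σ : ℝ} (hσ : -1 < σ) (δ : ℝ) :
    Tendsto (fun x : ℝ => x * (x ^ σ * Real.exp (-δ * x))) (𝓝[>] 0) (𝓝 0) := by
  have h1 : Tendsto (fun x : ℝ => x ^ (σ + 1) * Real.exp (-δ * x)) (𝓝 0)
      (𝓝 ((0 : ℝ) ^ (σ + 1) * Real.exp (-δ * 0))) := by
    refine ContinuousAt.tendsto (ContinuousAt.mul ?_ (by fun_prop))
    exact Real.continuousAt_rpow_const _ _ (Or.inr (by linarith))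
  rw [Real.zero_rpow (by linarith), zero_mul] at h1
  refine (h1.mono_left nhdsWithin_le_nhds).congr' ?_
  filter_upwards [self_mem_nhdsWithin] with x hx
  rw [Real.rpow_add hx, Real.rpow_one]; ring

theorem tendsto_mul_rpow_mul_exp_atTop (σ : ℝ) {δ : ℝ} (hδ : 0 < δ) :
    Tendsto (fun x : ℝ => x * (x ^ σ * Real.exp (-δ * x))) atTop (𝓝 0) := by
  refine (tendsto_rpow_mul_exp_neg_mul_atTop_nhds_zero (σ + 1) δ hδ).congr' ?_
  filter_upwards [eventually_gt_atTop 0] with x hx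
  rw [Real.rpow_add hx, Real.rpow_one]; ring

theorem integrableOn_rpow_mul_exp {σ δ : ℝ} (hσ : -1 < σ) (hδ : 0 < δ) (C : ℝ) :
    IntegrableOn (fun x : ℝ => C * (x ^ σ * Real.exp (-δ * x))) (Set.Ioi 0) := by
  have h := (integrableOn_rpow_mul_exp_neg_mul_rpow hσ one_pos hδ).const_mul C
  simp only [Real.rpow_one] at h
  exact h

theorem integrableOn_ray {g : ℂ → ℂ} {z d : ℂ} {C σ δ : ℝ} (hσ : -1 < σ) (hδ : 0 < δ)
    (hg : ∀ x : ℝ, 0 < x → ContinuousAt g (z + x * d))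
    (hb : ∀ x : ℝ, 0 < x → ‖g (z + x * d)‖ ≤ C * (x ^ σ * Real.exp (-δ * x))) :
    IntegrableOn (fun x : ℝ => g (z + x * d)) (Set.Ioi 0) := by
  refine (integrableOn_rpow_mul_exp hσ hδ C).mono' ?_ ?_
  · refine ContinuousOn.aestronglyMeasurable (fun x hx => ?_) measurableSet_Ioi
    exact (ContinuousAt.comp (f := fun x : ℝ => z + x * d) (hg x hx)
      (by fun_prop)).continuousWithinAt
  · exact (ae_restrict_iff' measurableSet_Ioi).2 (Eventually.of_forall hb)

/-- Only a one-sided limit at `a` is assumed, because the primitive on the wedge is not defined at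
the vertex, where the integrand may be singular. -/
theorem integral_Ioi_of_hasDerivAt_of_tendsto_nhdsGT {f f' : ℝ → ℂ} {a : ℝ} {l m : ℂ}
    (hl : Tendsto f (𝓝[>] a) (𝓝 l)) (hderiv : ∀ x ∈ Set.Ioi a, HasDerivAt f (f' x) x)
    (hint : IntegrableOn f' (Set.Ioi a)) (hm : Tendsto f atTop (𝓝 m)) :
    ∫ x in Set.Ioi a, f' x = m - l := by
  have hev : ∀ x ∈ Set.Ioi a, Function.update f a l =ᶠ[𝓝 x] f := fun x hx => by
    filter_upwards [Ioi_mem_nhds hx] with y hy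
    exact Function.update_of_ne (ne_of_gt hy) _ _
  have h := integral_Ioi_of_hasDerivAt_of_tendsto (f := Function.update f a l) (f' := f') (a := a)
    (m := m) ?_ (fun x hx => (hderiv x hx).congr_of_eventuallyEq (hev x hx)) hint ?_
  · rwa [Function.update_self] at h
  · rw [continuousWithinAt_update_same, Set.Ici_sdiff_left]
    exact hl
  · refine hm.congr' ?_
    filter_upwards [eventually_gt_atTop a] with y hy
    exact (Function.update_of_ne (ne_of_gt hy) _ _).symm

/-- Cauchy's theorem on a wedge: the integrals along its two sides agree. -/
theorem integral_ray_eq_of_wedge {g : ℂ → ℂ} {z d₁ d₂ : ℂ} {C σ δ : ℝ} (hσ : -1 < σ) (hδ : 0 < δ)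
    (hg : ∀ a b : ℝ, 0 ≤ a → 0 ≤ b → 0 < a + b → DifferentiableAt ℂ g (z + a * d₁ + b * d₂))
    (hb : ∀ a b : ℝ, 0 ≤ a → 0 ≤ b → 0 < a + b →
      ‖g (z + a * d₁ + b * d₂)‖ ≤ C * ((a + b) ^ σ * Real.exp (-δ * (a + b)))) :
    ∫ x in Set.Ioi (0 : ℝ), g (z + x * d₁) * d₁ = ∫ x in Set.Ioi (0 : ℝ), g (z + x * d₂) * d₂ := by
  -- The wedge without its vertex is still convex, so `g` has a primitive `P` on it.
  set S : Set ℂ := {t | ∃ a b : ℝ, 0 ≤ a ∧ 0 ≤ b ∧ 0 < a + b ∧ t = z + a * d₁ + b * d₂} with hS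
  have hconv : Convex ℝ S := by
    rintro _ ⟨a, b, ha, hb, hab, rfl⟩ _ ⟨a', b', ha', hb', hab', rfl⟩ u v hu hv huv
    refine ⟨u * a + v * a', u * b + v * b', by positivity, by positivity, ?_, ?_⟩
    · rcases hu.eq_or_lt with rfl | hu
      · have : v = 1 := by linarith
        subst this; linarith
      · have := mul_pos hu hab
        have := mul_nonneg hv hab'.le
        nlinarith
    · have hz : z = (u : ℂ) * z + (v : ℂ) * z := by
        rw [← add_mul, ← Complex.ofReal_add, huv]; simp
      simp only [Complex.real_smul]
      push_cast
      linear_combination -hz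
  have hgS : DifferentiableOn ℂ g S := by
    rintro _ ⟨a, b, ha, hb, hab, rfl⟩
    exact (hg a b ha hb hab).differentiableWithinAt
  obtain ⟨P, hP⟩ := hconv.exists_forall_hasDerivWithinAt hgS
  have hm1 : ∀ x : ℝ, 0 < x → z + x * d₁ ∈ S := fun x hx => ⟨x, 0, hx.le, le_rfl, by simpa, by simp⟩
  have hm2 : ∀ x : ℝ, 0 < x → z + x * d₂ ∈ S := fun x hx => ⟨0, x, le_rfl, hx.le, by simpa, by simp⟩
  have hder : ∀ d : ℂ, (∀ x : ℝ, 0 < x → z + x * d ∈ S) → ∀ x : ℝ, 0 < x →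
      HasDerivAt (fun x : ℝ => P (z + x * d)) (g (z + x * d) * d) x := by
    intro d hd x hx
    have h1 : HasDerivWithinAt (fun x : ℝ => z + x * d) d (Set.Ioi 0) x := by
      have := ((Complex.ofRealCLM.hasDerivAt (x := x)).mul_const d).const_add z
      simpa using this.hasDerivWithinAt
    have h2 := (hP _ (hd x hx)).scomp (t' := S) x h1 (fun y hy => hd y hy)
    rw [smul_eq_mul, mul_comm] at h2
    exact h2.hasDerivAt (Ioi_mem_nhds hx)
  have hi1 : IntegrableOn (fun x : ℝ => g (z + x * d₁) * d₁) (Set.Ioi 0) := by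
    refine (integrableOn_ray hσ hδ (C := C) (fun x hx => ?_) (fun x hx => ?_)).mul_const d₁
    · simpa using (hg x 0 hx.le le_rfl (by simpa)).continuousAt
    · simpa using hb x 0 hx.le le_rfl (by simpa)
  have hi2 : IntegrableOn (fun x : ℝ => g (z + x * d₂) * d₂) (Set.Ioi 0) := by
    refine (integrableOn_ray hσ hδ (C := C) (fun x hx => ?_) (fun x hx => ?_)).mul_const d₂
    · simpa using (hg 0 x le_rfl hx.le (by simpa)).continuousAt
    · simpa using hb 0 x le_rfl hx.le (by simpa)
  -- Mean value inequality on the segment across the wedge, where `a + b = x` throughout. The bound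
  -- vanishes at infinity, and at `0` because `σ > -1`.
  have hQ : ∀ x : ℝ, 0 < x → ‖P (z + x * d₁) - P (z + x * d₂)‖ ≤
      C * ‖d₁ - d₂‖ * (x * (x ^ σ * Real.exp (-δ * x))) := by
    intro x hx
    have hseg : segment ℝ (z + x * d₂) (z + x * d₁) ⊆ S :=
      hconv.segment_subset (hm2 x hx) (hm1 x hx)
    have := Convex.norm_image_sub_le_of_norm_hasDerivWithin_le
      (s := segment ℝ (z + x * d₂) (z + x * d₁)) (f := P) (f' := g)
      (C := C * (x ^ σ * Real.exp (-δ * x)))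
      (fun t ht => (hP t (hseg ht)).mono hseg) ?_ (convex_segment _ _)
      (left_mem_segment _ _ _) (right_mem_segment _ _ _)
    · refine this.trans (le_of_eq ?_)
      rw [add_sub_add_left_eq_sub, ← mul_sub, norm_mul, Complex.norm_real, Real.norm_of_nonneg hx.le]
      ring
    · rintro _ ⟨u, v, hu, hv, huv, rfl⟩
      have h := hb (v * x) (u * x) (by positivity) (by positivity) (by nlinarith)
      rw [← add_mul, add_comm v u, huv, one_mul] at h
      have ht : u • (z + x * d₂) + v • (z + x * d₁) =
          z + ((v * x : ℝ) : ℂ) * d₁ + ((u * x : ℝ) : ℂ) * d₂ := by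
        have hz : (u : ℂ) + v = 1 := by exact_mod_cast huv
        simp only [Complex.real_smul]
        push_cast
        linear_combination z * hz
      rwa [ht]
  have h0 : Tendsto (fun x : ℝ => P (z + x * d₁) - P (z + x * d₂)) (𝓝[>] 0) (𝓝 0) := by
    have h := (tendsto_mul_rpow_mul_exp_nhdsGT_zero hσ δ).const_mul (C * ‖d₁ - d₂‖)
    rw [mul_zero] at h
    refine squeeze_zero_norm' ?_ h
    filter_upwards [self_mem_nhdsWithin] with x hx using hQ x hx
  have h1 : Tendsto (fun x : ℝ => P (z + x * d₁) - P (z + x * d₂)) atTop (𝓝 0) := by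
    have h := (tendsto_mul_rpow_mul_exp_atTop σ hδ).const_mul (C * ‖d₁ - d₂‖)
    rw [mul_zero] at h
    refine squeeze_zero_norm' ?_ h
    filter_upwards [eventually_gt_atTop 0] with x hx using hQ x hx
  have key' : ∫ x in Set.Ioi (0 : ℝ), (g (z + x * d₁) * d₁ - g (z + x * d₂) * d₂) = 0 - 0 :=
    integral_Ioi_of_hasDerivAt_of_tendsto_nhdsGT h0
      (fun x hx => (hder d₁ hm1 x hx).sub (hder d₂ hm2 x hx)) (hi1.sub hi2) h1
  rw [integral_sub hi1 hi2, sub_zero] at key'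
  exact sub_eq_zero.1 key'

/-! ### Bounds for `t ^ κ * exp (-w t)` on a wedge. -/

theorem norm_cpow_le_rpow_mul_exp (t κ : ℂ) :
    ‖t ^ κ‖ ≤ ‖t‖ ^ κ.re * Real.exp (Real.pi * |κ.im|) := by
  refine (Complex.norm_cpow_le t κ).trans ?_
  rw [div_eq_mul_inv, ← Real.exp_neg]
  gcongr
  calc -(t.arg * κ.im) ≤ |t.arg * κ.im| := neg_le_abs _
    _ = |t.arg| * |κ.im| := abs_mul _ _
    _ ≤ _ := by gcongr; exact Complex.abs_arg_le_pi t

theorem exists_rpow_le_exp (ρ : ℝ) {c ε : ℝ} (hc : 0 < c) (hε : 0 < ε) :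
    ∃ C : ℝ, 0 < C ∧ ∀ r, c ≤ r → r ^ ρ ≤ C * Real.exp (ε * r) := by
  rcases le_or_gt ρ 0 with hρ | hρ
  · refine ⟨c ^ ρ, by positivity, fun r hr => ?_⟩
    have hr0 : 0 < r := hc.trans_le hr
    calc r ^ ρ ≤ c ^ ρ := Real.rpow_le_rpow_of_nonpos hc hr hρ
      _ = c ^ ρ * 1 := (mul_one _).symm
      _ ≤ _ := by gcongr; exact Real.one_le_exp (by positivity)
  · refine ⟨(ρ / ε) ^ ρ, by positivity, fun r hr => ?_⟩
    have hr0 : 0 < r := hc.trans_le hr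
    have h1 : r ≤ ρ / ε * Real.exp (ε * r / ρ) := by
      have := Real.add_one_le_exp (ε * r / ρ)
      calc r = ρ / ε * (ε * r / ρ) := by field_simp
        _ ≤ _ := by gcongr; linarith
    calc r ^ ρ ≤ (ρ / ε * Real.exp (ε * r / ρ)) ^ ρ := by gcongr
      _ = _ := by
        rw [Real.mul_rpow (by positivity) (by positivity), ← Real.exp_mul]
        congr 2; field_simp

theorem exists_norm_cpow_le_exp (κ : ℂ) {c ε : ℝ} (hc : 0 < c) (hε : 0 < ε) :
    ∃ C : ℝ, 0 < C ∧ ∀ t : ℂ, c ≤ ‖t‖ → ‖t ^ κ‖ ≤ C * Real.exp (ε * ‖t‖) := by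
  obtain ⟨C, hC, h⟩ := exists_rpow_le_exp κ.re hc hε
  refine ⟨C * Real.exp (Real.pi * |κ.im|), by positivity, fun t ht => ?_⟩
  refine (norm_cpow_le_rpow_mul_exp t κ).trans ?_
  rw [mul_right_comm]
  gcongr
  exact h _ ht

theorem wedge_re_ge {w z d₁ d₂ : ℂ} {a b : ℝ} (ha : 0 ≤ a) (hb : 0 ≤ b) :
    (w * z).re + min (w * d₁).re (w * d₂).re * (a + b) ≤ (w * (z + a * d₁ + b * d₂)).re := by
  have h : w * (z + a * d₁ + b * d₂) = w * z + a * (w * d₁) + b * (w * d₂) := by ring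
  rw [h, Complex.add_re, Complex.add_re, Complex.re_ofReal_mul, Complex.re_ofReal_mul]
  nlinarith [mul_le_mul_of_nonneg_left (min_le_left (w * d₁).re (w * d₂).re) ha,
    mul_le_mul_of_nonneg_left (min_le_right (w * d₁).re (w * d₂).re) hb]

theorem norm_wedge_le {z d₁ d₂ : ℂ} {a b : ℝ} (ha : 0 ≤ a) (hb : 0 ≤ b) :
    ‖z + a * d₁ + b * d₂‖ ≤ ‖z‖ + (‖d₁‖ + ‖d₂‖) * (a + b) := by
  refine (norm_add₃_le).trans ?_
  rw [norm_mul, norm_mul, Complex.norm_real, Complex.norm_real, Real.norm_of_nonneg ha,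
    Real.norm_of_nonneg hb]
  nlinarith [norm_nonneg d₁, norm_nonneg d₂, mul_nonneg ha (norm_nonneg d₂),
    mul_nonneg hb (norm_nonneg d₁)]

theorem exists_pos_le_norm_wedge {w z d₁ d₂ : ℂ} (h₁ : 0 < (w * d₁).re) (h₂ : 0 < (w * d₂).re)
    (h : ∀ a b : ℝ, 0 ≤ a → 0 ≤ b → z + a * d₁ + b * d₂ ≠ 0) :
    ∃ c : ℝ, 0 < c ∧ ∀ a b : ℝ, 0 ≤ a → 0 ≤ b → c ≤ ‖z + a * d₁ + b * d₂‖ := by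
  set δ := min (w * d₁).re (w * d₂).re with hδ
  have hδ0 : 0 < δ := lt_min h₁ h₂
  have hw : 0 < ‖w‖ := norm_pos_iff.2 (by rintro rfl; simp at h₁)
  -- Chosen so that `a + b ≥ R` forces the real part of `w` times the point to be at least `1`; the
  -- rest is compact.
  set R := (1 + |(w * z).re|) / δ with hR
  have hR0 : 0 < R := by positivity
  -- The absolute values make the minimum nonzero by `h` without recalling that the minimiser lies
  -- in the box.
  obtain ⟨p, -, hp⟩ := (isCompact_Icc (a := ((0 : ℝ), (0 : ℝ))) (b := (R, R))).exists_isMinOn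
    ⟨(0, 0), by simp [hR0.le]⟩
    (f := fun p : ℝ × ℝ => ‖z + (|p.1| : ℝ) * d₁ + (|p.2| : ℝ) * d₂‖) (by fun_prop)
  refine ⟨min ‖z + (|p.1| : ℝ) * d₁ + (|p.2| : ℝ) * d₂‖ (1 / ‖w‖),
    lt_min (norm_pos_iff.2 (h _ _ (abs_nonneg _) (abs_nonneg _))) (by positivity),
    fun a b ha hb => ?_⟩
  by_cases hab : a ≤ R ∧ b ≤ R
  · refine (min_le_left _ _).trans ?_
    have := hp (a := (a, b)) ⟨⟨ha, hb⟩, hab⟩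
    simpa only [Set.mem_ofPred_eq, abs_of_nonneg ha, abs_of_nonneg hb] using this
  · refine (min_le_right _ _).trans ?_
    have h1 : R ≤ a + b := by
      by_contra hlt
      exact hab ⟨by linarith, by linarith⟩
    have h2 := wedge_re_ge (w := w) (z := z) (d₁ := d₁) (d₂ := d₂) ha hb
    have h3 : δ * R = 1 + |(w * z).re| := by rw [hR]; field_simp
    have h4 : δ * R ≤ δ * (a + b) := by gcongr
    have h5 := (Complex.re_le_norm (w * (z + a * d₁ + b * d₂)))
    rw [norm_mul] at h5
    rw [div_le_iff₀' hw]
    have := neg_abs_le (w * z).re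
    linarith

/-- If `z = 0`, the norm of the point is comparable to `a + b`, so `σ = κ.re` works. If `z ≠ 0`, the
wedge stays away from `0`; the power then costs at most half of the exponential decay, and `σ = 0`.
-/
theorem exists_norm_cpow_mul_exp_le_wedge {κ w z d₁ d₂ : ℂ} (h₁ : 0 < (w * d₁).re)
    (h₂ : 0 < (w * d₂).re)
    (h : ∀ a b : ℝ, 0 ≤ a → 0 ≤ b → 0 < a + b → z + a * d₁ + b * d₂ ≠ 0)
    (hz : z ≠ 0 ∨ -1 < κ.re) :
    ∃ C σ δ : ℝ, -1 < σ ∧ 0 < δ ∧ ∀ a b : ℝ, 0 ≤ a → 0 ≤ b → 0 < a + b →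
      ‖(z + a * d₁ + b * d₂) ^ κ * Complex.exp (-(w * (z + a * d₁ + b * d₂)))‖ ≤
        C * ((a + b) ^ σ * Real.exp (-δ * (a + b))) := by
  set δ := min (w * d₁).re (w * d₂).re with hδ
  have hδ0 : 0 < δ := lt_min h₁ h₂
  have hw : 0 < ‖w‖ := norm_pos_iff.2 (by rintro rfl; simp at h₁)
  have hd1 : 0 < ‖d₁‖ := norm_pos_iff.2 (by rintro rfl; simp at h₁)
  have hre : ∀ a b : ℝ, 0 ≤ a → 0 ≤ b →
      ‖Complex.exp (-(w * (z + a * d₁ + b * d₂)))‖ ≤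
        Real.exp (-(w * z).re) * Real.exp (-δ * (a + b)) := by
    intro a b ha hb
    rw [Complex.norm_exp, ← Real.exp_add, Complex.neg_re]
    have := wedge_re_ge (w := w) (z := z) (d₁ := d₁) (d₂ := d₂) ha hb
    gcongr
    linarith
  set D := ‖d₁‖ + ‖d₂‖ with hD
  have hD0 : 0 < D := by positivity
  rcases eq_or_ne z 0 with rfl | hz0
  · have hκ : -1 < κ.re := by tauto
    set c := δ / ‖w‖ with hc
    have hc0 : 0 < c := by positivity
    refine ⟨(c ^ κ.re + D ^ κ.re) * Real.exp (Real.pi * |κ.im|), κ.re, δ, hκ, hδ0,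
      fun a b ha hb hab => ?_⟩
    rw [norm_mul]
    have h3 := norm_cpow_le_rpow_mul_exp (0 + a * d₁ + b * d₂) κ
    have h4 := hre a b ha hb
    simp only [mul_zero, Complex.zero_re, neg_zero, Real.exp_zero, one_mul] at h4
    set t := (0 : ℂ) + a * d₁ + b * d₂ with ht
    have ht' : t = a * d₁ + b * d₂ := by rw [ht, zero_add]
    have hlow : c * (a + b) ≤ ‖t‖ := by
      have h2 := wedge_re_ge (w := w) (z := 0) (d₁ := d₁) (d₂ := d₂) ha hb
      have h5 := (Complex.re_le_norm (w * t))
      rw [norm_mul] at h5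
      rw [hc, div_mul_eq_mul_div, div_le_iff₀' hw]
      simp only [mul_zero, Complex.zero_re, zero_add] at h2 h5 ht
      rw [ht] at h5 ⊢
      linarith
    have hup : ‖t‖ ≤ D * (a + b) := by
      rw [ht']
      simpa only [norm_zero, zero_add] using norm_wedge_le (z := 0) (d₁ := d₁) (d₂ := d₂) ha hb
    -- One summand serves `κ.re ≤ 0`, the other `κ.re > 0`.
    have hpow : ‖t‖ ^ κ.re ≤ (c ^ κ.re + D ^ κ.re) * (a + b) ^ κ.re := by
      rw [add_mul, ← Real.mul_rpow hc0.le hab.le, ← Real.mul_rpow hD0.le hab.le]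
      rcases le_or_gt κ.re 0 with hk | hk
      · have := Real.rpow_le_rpow_of_nonpos (by positivity) hlow hk
        have : 0 ≤ (D * (a + b)) ^ κ.re := by positivity
        linarith
      · have := Real.rpow_le_rpow (norm_nonneg _) hup hk.le
        have : 0 ≤ (c * (a + b)) ^ κ.re := by positivity
        linarith
    calc ‖t ^ κ‖ * ‖Complex.exp (-(w * t))‖
        ≤ (‖t‖ ^ κ.re * Real.exp (Real.pi * |κ.im|)) * Real.exp (-δ * (a + b)) := by gcongr
      _ ≤ (((c ^ κ.re + D ^ κ.re) * (a + b) ^ κ.re) * Real.exp (Real.pi * |κ.im|)) *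
          Real.exp (-δ * (a + b)) := by gcongr
      _ = _ := by ring
  · obtain ⟨c, hc0, hc⟩ := exists_pos_le_norm_wedge h₁ h₂ (z := z) (fun a b ha hb => by
      rcases (add_nonneg ha hb).eq_or_lt with h0 | h0
      · have ha0 : a = 0 := by linarith
        have hb0 : b = 0 := by linarith
        simpa [ha0, hb0] using hz0
      · exact h a b ha hb h0)
    obtain ⟨C, hC0, hC⟩ := exists_norm_cpow_le_exp κ hc0 (ε := δ / (2 * D)) (by positivity)
    refine ⟨C * Real.exp (δ / (2 * D) * ‖z‖) * Real.exp (-(w * z).re), 0, δ / 2, by norm_num,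
      by positivity, fun a b ha hb hab => ?_⟩
    have h3 := hC _ (hc a b ha hb)
    have h4 := hre a b ha hb
    have h5 := norm_wedge_le (z := z) (d₁ := d₁) (d₂ := d₂) ha hb
    rw [norm_mul]
    set t := z + a * d₁ + b * d₂ with ht
    calc ‖t ^ κ‖ * ‖Complex.exp (-(w * t))‖
        ≤ (C * Real.exp (δ / (2 * D) * ‖t‖)) *
          (Real.exp (-(w * z).re) * Real.exp (-δ * (a + b))) := by gcongr
      _ ≤ (C * Real.exp (δ / (2 * D) * (‖z‖ + D * (a + b)))) *
          (Real.exp (-(w * z).re) * Real.exp (-δ * (a + b))) := by gcongr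
      _ = _ := by
        have h6 : δ / (2 * D) * (‖z‖ + D * (a + b)) =
          δ / (2 * D) * ‖z‖ + δ / 2 * (a + b) := by field_simp
        have h7 : -(δ / 2) * (a + b) = δ / 2 * (a + b) + -δ * (a + b) := by ring
        rw [h6, h7, Real.exp_add, Real.exp_add, Real.rpow_zero]
        ring

/-! ### Integrals along rays: rotation and scaling. -/

/-- The integral of `t ^ κ * exp (-w t)` along the ray from `z` in the direction `d`. -/
noncomputable def rayIntegral (κ w z d : ℂ) : ℂ :=
  ∫ x in Set.Ioi (0 : ℝ), (z + x * d) ^ κ * Complex.exp (-(w * (z + x * d))) * d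

theorem upperIncompleteGamma_eq_rayIntegral (s z : ℂ) :
    upperIncompleteGamma s z = rayIntegral (s - 1) 1 z (rayDir z) := by
  simp only [upperIncompleteGamma, rayIntegral, one_mul]

theorem rayIntegral_rotate {κ w z d₁ d₂ : ℂ} (h₁ : 0 < (w * d₁).re) (h₂ : 0 < (w * d₂).re)
    (h : ∀ a b : ℝ, 0 ≤ a → 0 ≤ b → 0 < a + b → z + a * d₁ + b * d₂ ∈ Complex.slitPlane)
    (hz : z ≠ 0 ∨ -1 < κ.re) : rayIntegral κ w z d₁ = rayIntegral κ w z d₂ := by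
  obtain ⟨C, σ, δ, hσ, hδ, hb⟩ := exists_norm_cpow_mul_exp_le_wedge h₁ h₂
    (fun a b ha hb hab => Complex.slitPlane_ne_zero (h a b ha hb hab)) hz
  refine integral_ray_eq_of_wedge (g := fun t => t ^ κ * Complex.exp (-(w * t))) hσ hδ
    (fun a b ha hb hab => ?_) hb
  refine DifferentiableAt.mul ?_ (by fun_prop)
  exact (differentiableAt_id).cpow_const (h a b ha hb hab)

theorem integrableOn_cpow_mul_exp_ray {κ w z d : ℂ} (hd : 0 < (w * d).re)
    (h : ∀ x : ℝ, 0 < x → z + x * d ∈ Complex.slitPlane) (hz : z ≠ 0 ∨ -1 < κ.re) :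
    IntegrableOn (fun x : ℝ => (z + x * d) ^ κ * Complex.exp (-(w * (z + x * d))))
      (Set.Ioi 0) := by
  obtain ⟨C, σ, δ, hσ, hδ, hb⟩ := exists_norm_cpow_mul_exp_le_wedge (d₁ := d) (d₂ := d) hd hd
    (fun a b ha hb hab => by
      have := Complex.slitPlane_ne_zero (h (a + b) hab)
      push_cast at this
      rwa [add_mul, ← add_assoc] at this) hz
  refine integrableOn_ray (g := fun t => t ^ κ * Complex.exp (-(w * t))) (C := C) hσ hδ
    (fun x hx => ?_) (fun x hx => ?_)
  · exact (continuousAt_id.cpow continuousAt_const (h x hx)).mul (by fun_prop)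
  · simpa using hb x 0 hx.le le_rfl (by simpa)

/-- Substitution `t ↦ w t`. Multiplicativity of the power is left as a hypothesis since its reason
varies: a sum of arguments in range, or an integer exponent. -/
theorem rayIntegral_scale {κ w z d : ℂ} (hw : w ≠ 0)
    (h : ∀ x : ℝ, 0 < x → (w * (z + x * d)) ^ κ = w ^ κ * (z + x * d) ^ κ) :
    rayIntegral κ 1 (w * z) (w * d) = w ^ (κ + 1) * rayIntegral κ w z d := by
  rw [rayIntegral, rayIntegral, ← integral_const_mul]
  refine setIntegral_congr_fun measurableSet_Ioi fun x hx => ?_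
  have h1 : w * z + x * (w * d) = w * (z + x * d) := by ring
  simp only [h1, h x hx, one_mul]
  rw [Complex.cpow_add _ _ hw, Complex.cpow_one]
  ring

/-! ### Pointwise convergence of Fourier series with independent cutoffs. -/

theorem sum_Icc_neg_eq_sum_range {E : Type*} [AddCommMonoid E] (f : ℤ → E) (M N : ℕ) :
    ∑ n ∈ Finset.Icc (-(M : ℤ)) (N : ℤ), f n =
      ∑ i ∈ Finset.range (M + N + 1), f (-(M : ℤ) + i) := by
  symm
  refine Finset.sum_nbij (fun i => -(M : ℤ) + i) ?_ ?_ ?_ (fun _ _ => rfl)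
  · intro i hi
    simp only [Finset.mem_range, Finset.mem_Icc] at *
    omega
  · intro i _ j _ hij
    simpa using hij
  · intro n hn
    simp only [Finset.coe_Icc, Set.mem_Icc] at hn
    refine ⟨(n + M).toNat, ?_, ?_⟩
    · simp only [Finset.coe_range, Set.mem_Iio]; omega
    · simp only; omega

theorem sum_Icc_neg_sub {E : Type*} [AddCommGroup E] (f : ℤ → E) (M N : ℕ) :
    ∑ n ∈ Finset.Icc (-(M : ℤ)) (N : ℤ), (f n - f (n + 1)) = f (-(M : ℤ)) - f (N + 1) := by
  rw [sum_Icc_neg_eq_sum_range]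
  have := Finset.sum_range_sub' (fun i : ℕ => f (-(M : ℤ) + i)) (M + N + 1)
  simp only [Nat.cast_add, Nat.cast_one, Nat.cast_zero, add_zero] at this
  convert this using 2
  · congr 1; ring_nf
  · congr 1; ring

/-- The Riemann–Lebesgue lemma, restricted to integer frequencies. -/
theorem tendsto_integral_mul_exp_cofinite {s : Set ℝ} (hs : MeasurableSet s) (H : ℝ → ℂ) :
    Tendsto (fun n : ℤ => ∫ y in s, H y * Complex.exp (-(Complex.I * n * y))) cofinite (𝓝 0) := by
  have h := Real.tendsto_integral_exp_smul_cocompact (s.indicator H)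
  have h2 : Tendsto (fun n : ℤ => (n : ℝ) / (2 * Real.pi)) cofinite (cocompact ℝ) := by
    have h3 : Tendsto (fun n : ℤ => (n : ℝ)) cofinite (cocompact ℝ) :=
      Int.tendsto_coe_cofinite
    have h4 : IsClosedEmbedding (fun x : ℝ => x / (2 * Real.pi)) :=
      by
      simpa [div_eq_mul_inv] using
        (Homeomorph.mulRight₀ (2 * Real.pi)⁻¹ (by positivity)).isClosedEmbedding
    exact h4.tendsto_cocompact.comp h3
  refine (h.comp h2).congr fun n => ?_
  simp only [Function.comp]
  rw [← integral_indicator hs]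
  congr 1
  ext y
  by_cases hy : y ∈ s
  · rw [Set.indicator_of_mem hy, Set.indicator_of_mem hy, Circle.smul_def, Real.fourierChar_apply,
      smul_eq_mul, mul_comm]
    congr 2
    push_cast
    have : (Real.pi : ℂ) ≠ 0 := by exact_mod_cast Real.pi_ne_zero
    field_simp
  · simp [Set.indicator_of_notMem hy]

theorem integrableOn_const_Ioc {c : ℂ} {a b : ℝ} : IntegrableOn (fun _ => c) (Set.Ioc a b) :=
  integrableOn_const (by rw [Real.volume_Ioc]; exact ENNReal.ofReal_ne_top)

/-- The divided difference at `β` of `y ↦ 1 - e^{i(β-y)}` is continuous. It has no zero on `[0,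
2π]`, since `0 < β < 2π` makes `β` the only zero of the function there and that zero is simple.
Compactness gives the constant. -/
theorem exists_pos_mul_abs_le_norm_one_sub_exp {β : ℝ} (h₀ : 0 < β) (h₁ : β < 2 * Real.pi) :
    ∃ c : ℝ, 0 < c ∧ ∀ y ∈ Set.Icc 0 (2 * Real.pi),
      c * |y - β| ≤ ‖1 - Complex.exp (Complex.I * (β - y))‖ := by
  set f : ℝ → ℂ := fun y => 1 - Complex.exp (Complex.I * (β - y)) with hf
  have hfd : ∀ y : ℝ, HasDerivAt f (Complex.I * Complex.exp (Complex.I * (β - y))) y := by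
    intro y
    have h1 : HasDerivAt (fun y : ℝ => Complex.I * ((β : ℂ) - y)) (Complex.I * (0 - 1)) y := by
      have := (Complex.ofRealCLM.hasDerivAt (x := y))
      simp only [Complex.ofRealCLM_apply, Complex.ofReal_one] at this
      exact ((hasDerivAt_const y (β : ℂ)).sub this).const_mul _
    have := (h1.cexp).const_sub 1
    rwa [show -(Complex.exp (Complex.I * ((β : ℂ) - y)) * (Complex.I * (0 - 1))) =
      Complex.I * Complex.exp (Complex.I * (β - y)) by ring] at this
  have hfβ : f β = 0 := by simp [hf]
  have hcont : Continuous (dslope f β) := by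
    rw [continuous_iff_continuousAt]
    intro y
    rcases eq_or_ne y β with rfl | hy
    · exact continuousAt_dslope_same.2 (hfd _).differentiableAt
    · exact (continuousAt_dslope_of_ne hy).2 (hfd _).continuousAt
  have hne : ∀ y ∈ Set.Icc 0 (2 * Real.pi), dslope f β y ≠ 0 := by
    intro y hy
    rcases eq_or_ne y β with rfl | hyb
    · rw [dslope_same, (hfd _).deriv]
      simp
    · rw [dslope_of_ne _ hyb, slope_def_module, hfβ, sub_zero]
      refine smul_ne_zero (inv_ne_zero (sub_ne_zero.2 hyb)) ?_
      intro h0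
      have h1 : Complex.exp (Complex.I * (β - y)) = 1 := (sub_eq_zero.1 h0).symm
      obtain ⟨n, hn⟩ := Complex.exp_eq_one_iff.1 h1
      have h2 : ((β - y : ℝ) : ℂ) = ((n * (2 * Real.pi) : ℝ) : ℂ) := by
        push_cast
        have := Complex.I_ne_zero
        have h3 : Complex.I * ((β - y) - n * (2 * Real.pi)) = 0 := by linear_combination hn
        rcases mul_eq_zero.1 h3 with h | h
        · exact absurd h this
        · linear_combination h
      have h3 : β - y = n * (2 * Real.pi) := by exact_mod_cast h2
      have hn1 : (n : ℝ) < 1 := by nlinarith [hy.1, hy.2]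
      have hn2 : (-1 : ℝ) < n := by nlinarith [hy.1, hy.2]
      have hn3 : n = 0 := by
        have : n < 1 := by exact_mod_cast hn1
        have : -1 < n := by exact_mod_cast hn2
        omega
      rw [hn3] at h3
      apply hyb
      simp at h3
      linarith
  obtain ⟨p, hp, hmin⟩ := (isCompact_Icc (a := (0 : ℝ)) (b := 2 * Real.pi)).exists_isMinOn
    ⟨0, by simp [Real.pi_pos.le]⟩ (f := fun y => ‖dslope f β y‖) hcont.norm.continuousOn
  refine ⟨‖dslope f β p‖, norm_pos_iff.2 (hne p hp), fun y hy => ?_⟩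
  have h1 := sub_smul_dslope f β y
  rw [hfβ, sub_zero] at h1
  change _ ≤ ‖f y‖
  rw [← h1, norm_smul, Real.norm_eq_abs, mul_comm]
  have := hmin hy
  simp only [Set.mem_ofPred_eq] at this
  gcongr

theorem integral_exp_I_int_mul_sub (β : ℝ) (n : ℤ) :
    ∫ y in Set.Ioc 0 (2 * Real.pi), Complex.exp (Complex.I * n * (β - y)) =
      if n = 0 then 2 * (Real.pi : ℂ) else 0 := by
  rw [← intervalIntegral.integral_of_le (by positivity)]
  split_ifs with hn
  · simp [hn]
  · have hc : -(Complex.I * n) ≠ 0 := by simp [hn]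
    have h : ∀ y : ℝ, Complex.exp (Complex.I * n * (β - y)) =
        Complex.exp (Complex.I * n * β) * Complex.exp (-(Complex.I * n) * y) := by
      intro y
      rw [← Complex.exp_add]; ring_nf
    simp_rw [h]
    rw [intervalIntegral.integral_const_mul, integral_exp_mul_complex hc]
    have : Complex.exp (-(Complex.I * n) * ((2 * Real.pi : ℝ) : ℂ)) = 1 :=
      Complex.exp_eq_one_iff.2 ⟨-n, by push_cast; ring⟩
    rw [this]
    simp

/-- Pointwise convergence of the Fourier series of a function on `(0, 2π)` at a point of
differentiability. -/
theorem tendsto_sum_integral_mul_exp {G : ℝ → ℂ} {β : ℝ} (h₀ : 0 < β) (h₁ : β < 2 * Real.pi)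
    (hG : IntegrableOn G (Set.Ioc 0 (2 * Real.pi))) (hd : DifferentiableAt ℝ G β) :
    Tendsto (fun N : ℕ × ℕ => ∑ n ∈ Finset.Icc (-(N.1 : ℤ)) (N.2 : ℤ),
      ∫ y in Set.Ioc 0 (2 * Real.pi), G y * Complex.exp (Complex.I * n * (β - y)))
      atTop (𝓝 (2 * Real.pi * G β)) := by
  obtain ⟨c, hc0, hc⟩ := exists_pos_mul_abs_le_norm_one_sub_exp h₀ h₁
  -- Differentiability at `β` makes this quotient integrable. Since `G - G β = H (1 - e^{i(β-y)})`,
  -- the integrals of `G` telescope into differences of the coefficients `A n` of `H`, which tend to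
  -- `0`; the constant `G β` contributes only for `n = 0`.
  set H : ℝ → ℂ := fun y => (G y - G β) / (1 - Complex.exp (Complex.I * (β - y))) with hH
  have hsub : IntegrableOn (fun y => G y - G β) (Set.Ioc 0 (2 * Real.pi)) :=
    hG.sub integrableOn_const_Ioc
  obtain ⟨K, hK⟩ := (hd.isBigO_sub).bound
  obtain ⟨δ, hδ0, hδ⟩ := Metric.eventually_nhds_iff.1 hK
  have hHint : IntegrableOn H (Set.Ioc 0 (2 * Real.pi)) := by
    refine Integrable.mono' (g := fun y => c⁻¹ * (|K| + δ⁻¹ * ‖G y - G β‖))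
      (((integrableOn_const (by rw [Real.volume_Ioc]; exact ENNReal.ofReal_ne_top)).add (hsub.norm.const_mul δ⁻¹)).const_mul c⁻¹) ?_ ?_
    · refine hsub.aestronglyMeasurable.div₀ ?_
      exact Continuous.aestronglyMeasurable (by fun_prop)
    · refine (ae_restrict_iff' measurableSet_Ioc).2 (Eventually.of_forall fun y hy => ?_)
      rcases eq_or_ne y β with rfl | hyb
      · simp only [hH, sub_self, zero_div, norm_zero]
        positivity
      have hpos : 0 < |y - β| := abs_pos.2 (sub_ne_zero.2 hyb)
      have h2 := hc y ⟨hy.1.le, hy.2⟩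
      rw [hH]
      simp only
      rw [norm_div, div_le_iff₀ (lt_of_lt_of_le (by positivity) h2)]
      -- The first summand handles `y` near `β`, the second `|y - β| ≥ δ`.
      have h3 : ‖G y - G β‖ ≤ (|K| + δ⁻¹ * ‖G y - G β‖) * |y - β| := by
        rcases lt_or_ge (dist y β) δ with h | h
        · have h4 := hδ h
          rw [Real.norm_eq_abs] at h4
          have : K * |y - β| ≤ |K| * |y - β| := by gcongr; exact le_abs_self K
          have : 0 ≤ δ⁻¹ * ‖G y - G β‖ * |y - β| := by positivity
          linarith
        · rw [Real.dist_eq] at h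
          have : ‖G y - G β‖ = δ⁻¹ * ‖G y - G β‖ * δ := by field_simp
          have : δ⁻¹ * ‖G y - G β‖ * δ ≤ δ⁻¹ * ‖G y - G β‖ * |y - β| := by gcongr
          have : 0 ≤ |K| * |y - β| := by positivity
          linarith
      calc ‖G y - G β‖ ≤ (|K| + δ⁻¹ * ‖G y - G β‖) * |y - β| := h3
        _ = c⁻¹ * (|K| + δ⁻¹ * ‖G y - G β‖) * (c * |y - β|) := by field_simp
        _ ≤ _ := by gcongr
  have hbdd : ∀ n : ℤ, ∀ f : ℝ → ℂ, IntegrableOn f (Set.Ioc 0 (2 * Real.pi)) →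
      IntegrableOn (fun y : ℝ => f y * Complex.exp (Complex.I * n * (β - y)))
        (Set.Ioc 0 (2 * Real.pi)) := by
    intro n f hf
    refine hf.mul_bdd (c := 1) (Continuous.aestronglyMeasurable (by fun_prop))
      (Eventually.of_forall fun y => ?_)
    have : Complex.I * n * (β - y) = ((n * (β - y) : ℝ) : ℂ) * Complex.I := by push_cast; ring
    rw [this, Complex.norm_exp_ofReal_mul_I]
  set A : ℤ → ℂ := fun n => ∫ y in Set.Ioc 0 (2 * Real.pi),
    H y * Complex.exp (Complex.I * n * (β - y)) with hA
  have hA0 : Tendsto A cofinite (𝓝 0) := by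
    have h := tendsto_integral_mul_exp_cofinite (measurableSet_Ioc (a := 0) (b := 2 * Real.pi)) H
    rw [tendsto_zero_iff_norm_tendsto_zero] at h ⊢
    refine h.congr fun n => ?_
    rw [hA]
    simp only
    have h2 : ∀ y : ℝ, H y * Complex.exp (Complex.I * n * (β - y)) =
        Complex.exp ((n * β : ℝ) * Complex.I) * (H y * Complex.exp (-(Complex.I * n * y))) := by
      intro y
      have : Complex.I * n * (β - y) = (n * β : ℝ) * Complex.I + -(Complex.I * n * y) := by
        push_cast; ring
      rw [this, Complex.exp_add]; ring
    simp_rw [h2]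
    rw [integral_const_mul, norm_mul, Complex.norm_exp_ofReal_mul_I, one_mul]
  have hterm : ∀ n : ℤ, ∫ y in Set.Ioc 0 (2 * Real.pi), G y * Complex.exp (Complex.I * n * (β - y)) =
      (A n - A (n + 1)) + if n = 0 then 2 * Real.pi * G β else 0 := by
    intro n
    have h3 : (if n = 0 then 2 * Real.pi * G β else 0) =
        ∫ y in Set.Ioc 0 (2 * Real.pi), G β * Complex.exp (Complex.I * n * (β - y)) := by
      rw [integral_const_mul, integral_exp_I_int_mul_sub]
      split_ifs <;> ring
    have hi := hbdd n (fun _ => G β) integrableOn_const_Ioc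
    have hn0 := hbdd n H hHint
    have hn1 := hbdd (n + 1) H hHint
    have hs : A n - A (n + 1) = ∫ y in Set.Ioc 0 (2 * Real.pi),
        (H y * Complex.exp (Complex.I * n * (β - y)) -
          H y * Complex.exp (Complex.I * ((n + 1 : ℤ) : ℂ) * (β - y))) :=
      (integral_sub hn0 hn1).symm
    rw [h3, hs, ← integral_add (f := fun y : ℝ => H y * Complex.exp (Complex.I * n * (β - y)) -
          H y * Complex.exp (Complex.I * ((n + 1 : ℤ) : ℂ) * (β - y))) (hn0.sub hn1) hi]
    refine integral_congr_ae ?_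
    have hae : ∀ᵐ y ∂(volume.restrict (Set.Ioc 0 (2 * Real.pi))), y ≠ β :=
      ae_restrict_of_ae (Measure.ae_ne volume β)
    filter_upwards [hae, ae_restrict_mem measurableSet_Ioc] with y hyb hy
    have hpos : 0 < |y - β| := abs_pos.2 (sub_ne_zero.2 hyb)
    have h2 := hc y ⟨hy.1.le, hy.2⟩
    have hne : 1 - Complex.exp (Complex.I * (β - y)) ≠ 0 :=
      norm_pos_iff.1 (lt_of_lt_of_le (by positivity) h2)
    have hexp : Complex.exp (Complex.I * ((n + 1 : ℤ) : ℂ) * (β - y)) =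
        Complex.exp (Complex.I * n * (β - y)) * Complex.exp (Complex.I * (β - y)) := by
      rw [← Complex.exp_add]; push_cast; ring_nf
    simp only [hexp, hH]
    field_simp
    ring
  simp_rw [hterm, Finset.sum_add_distrib, sum_Icc_neg_sub]
  have hneg : Tendsto (fun N : ℕ × ℕ => A (-(N.1 : ℤ))) atTop (𝓝 0) := by
    refine hA0.comp ?_
    rw [← prod_atTop_atTop_eq, Int.cofinite_eq]
    exact ((tendsto_neg_atTop_atBot.comp tendsto_natCast_atTop_atTop).comp tendsto_fst).mono_right
      le_sup_left
  have hpos : Tendsto (fun N : ℕ × ℕ => A ((N.2 : ℤ) + 1)) atTop (𝓝 0) := by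
    refine hA0.comp (g := A) (f := fun N : ℕ × ℕ => (N.2 : ℤ) + 1) ?_
    rw [← prod_atTop_atTop_eq, Int.cofinite_eq]
    exact ((tendsto_atTop_add_const_right _ 1 tendsto_natCast_atTop_atTop).comp
      tendsto_snd).mono_right le_sup_right
  have hsum : ∀ N : ℕ × ℕ, ∑ n ∈ Finset.Icc (-(N.1 : ℤ)) (N.2 : ℤ),
      (if n = 0 then 2 * Real.pi * G β else 0) = 2 * Real.pi * G β := by
    intro N
    rw [Finset.sum_ite_eq' ]
    simp
  simp_rw [hsum]
  simpa using (hneg.sub hpos).add_const (2 * Real.pi * G β)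

/-! ### Uniqueness of the continuation, and the rational functions `Φ(z, -j, α)`. -/

theorem IsLerchContinuation.eqOn {U : Set ℂ} {s a : ℂ} {F₁ F₂ : ℂ → ℂ}
    (hU : IsPreconnected U) (h0 : (0 : ℂ) ∈ U) (h₁ : IsLerchContinuation U s a F₁)
    (h₂ : IsLerchContinuation U s a F₂) : Set.EqOn F₁ F₂ U := by
  refine h₁.1.eqOn_of_preconnected_of_eventuallyEq h₂.1 hU h0 ?_
  filter_upwards [Metric.ball_mem_nhds (0 : ℂ) one_pos] with z hz
  rw [mem_ball_zero_iff] at hz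
  rw [h₁.2 z hz, h₂.2 z hz]

theorem lerchPhi_of_norm_lt_one {z : ℂ} (hz : ‖z‖ < 1) (s a : ℂ) :
    lerchPhi z s a = lerchSeries z s a := by
  rw [lerchPhi, if_pos (Or.inl hz)]

theorem lerchPhi_eq_of_isLerchContinuation_compl {s a : ℂ} {F : ℂ → ℂ}
    (hF : IsLerchContinuation {1}ᶜ s a F) {z : ℂ} (hz : z ≠ 1) : lerchPhi z s a = F z := by
  by_cases h1 : ‖z‖ < 1
  · rw [lerchPhi_of_norm_lt_one h1, hF.2 z h1]
  · have h : ∃ F, IsLerchContinuation {1}ᶜ s a F := ⟨F, hF⟩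
    rw [lerchPhi, if_neg (by tauto), dif_pos h]
    refine h.choose_spec.eqOn ?_ (by simp) hF (by simpa using hz)
    exact (isConnected_compl_singleton_of_one_lt_rank (by simp) _).isPreconnected

/-- The rational functions continuing `∑ n, n ^ j * z ^ n`. -/
noncomputable def polylogNeg : ℕ → ℂ → ℂ
  | j, z => ((0 : ℂ) ^ j + z * ∑ l : Fin j, (j.choose l : ℂ) * polylogNeg l z) / (1 - z)

theorem polylogNeg_relation (j : ℕ) {z : ℂ} (hz : z ≠ 1) :
    polylogNeg j z - z * ∑ l ∈ Finset.range (j + 1), (j.choose l : ℂ) * polylogNeg l z = 0 ^ j := by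
  have h1 : 1 - z ≠ 0 := sub_ne_zero.2 hz.symm
  rw [Finset.sum_range_succ, Nat.choose_self, Nat.cast_one, one_mul]
  have h2 : polylogNeg j z * (1 - z) =
      (0 : ℂ) ^ j + z * ∑ l ∈ Finset.range j, (j.choose l : ℂ) * polylogNeg l z := by
    rw [polylogNeg, div_mul_cancel₀ _ h1, ← Fin.sum_univ_eq_sum_range
      (fun l => (j.choose l : ℂ) * polylogNeg l z)]
  linear_combination h2

theorem differentiableOn_polylogNeg (j : ℕ) : DifferentiableOn ℂ (polylogNeg j) {1}ᶜ := by
  induction j using Nat.strong_induction_on with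
  | _ j ih =>
    have h : polylogNeg j = fun z => ((0 : ℂ) ^ j + z * ∑ l : Fin j, (j.choose l : ℂ) *
        polylogNeg l z) / (1 - z) := by
      ext z; rw [polylogNeg]
    rw [h]
    have hs : DifferentiableOn ℂ (fun z => ∑ l : Fin j, (j.choose l : ℂ) * polylogNeg l z) {1}ᶜ :=
      DifferentiableOn.fun_sum fun (l : Fin j) _ => (ih l l.2).const_mul _
    exact ((differentiableOn_id.fun_mul hs).const_add _).fun_div
      (by fun_prop) fun z hz => sub_ne_zero.2 (Ne.symm hz)

/-- Splitting off the term `n = 0` and expanding `(n + 1)^j` by the binomial theorem gives the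
series the same recursion as `polylogNeg`. -/
theorem hasSum_polylogNeg {z : ℂ} (hz : ‖z‖ < 1) (j : ℕ) :
    HasSum (fun n : ℕ => (n : ℂ) ^ j * z ^ n) (polylogNeg j z) := by
  have hz1 : z ≠ 1 := by rintro rfl; simp at hz
  have h1 : 1 - z ≠ 0 := sub_ne_zero.2 hz1.symm
  have hsum : ∀ j : ℕ, Summable (fun n : ℕ => (n : ℂ) ^ j * z ^ n) := fun j =>
    summable_pow_mul_geometric_of_norm_lt_one j hz
  induction j using Nat.strong_induction_on with
  | _ j ih =>
    rw [(hsum j).hasSum_iff]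
    have h2 := (hsum j).tsum_eq_zero_add
    have h3 : HasSum (fun n : ℕ => ((n + 1 : ℕ) : ℂ) ^ j * z ^ (n + 1))
        (z * ∑ l ∈ Finset.range (j + 1), (j.choose l : ℂ) * ∑' n : ℕ, (n : ℂ) ^ l * z ^ n) := by
      have h4 := (hasSum_sum (f := fun (l : ℕ) (n : ℕ) => (j.choose l : ℂ) * ((n : ℂ) ^ l * z ^ n))
        (s := Finset.range (j + 1)) (fun l _ => (hsum l).hasSum.mul_left _)).mul_left z
      refine h4.congr_fun fun n => ?_
      push_cast
      rw [add_pow, Finset.sum_mul, Finset.mul_sum]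
      refine Finset.sum_congr rfl fun l _ => ?_
      rw [one_pow]; ring
    rw [h3.tsum_eq, Finset.sum_range_succ, Nat.choose_self, Nat.cast_one, one_mul] at h2
    have h5 : ∑ l ∈ Finset.range j, (j.choose l : ℂ) * ∑' n : ℕ, (n : ℂ) ^ l * z ^ n =
        ∑ l ∈ Finset.range j, (j.choose l : ℂ) * polylogNeg l z :=
      Finset.sum_congr rfl fun l hl => by rw [(ih l (Finset.mem_range.1 hl)).tsum_eq]
    rw [h5] at h2
    have h6 := polylogNeg_relation j hz1
    rw [Finset.sum_range_succ, Nat.choose_self, Nat.cast_one, one_mul] at h6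
    refine mul_right_cancel₀ h1 ?_
    simp only [Nat.cast_zero, pow_zero, mul_one] at h2
    linear_combination h2 - h6

/-- The continuation in `z` of `∑ n, (n + α) ^ j * z ^ n`. -/
noncomputable def lerchNeg (j : ℕ) (z α : ℂ) : ℂ :=
  ∑ l ∈ Finset.range (j + 1), (j.choose l : ℂ) * polylogNeg l z * α ^ (j - l)

/-- In `α` these polynomials satisfy the Appell relation, which drives both the shift identity and
the later integration by parts. -/
theorem hasDerivAt_lerchNeg (j : ℕ) (z α : ℂ) :
    HasDerivAt (lerchNeg (j + 1) z) ((j + 1) * lerchNeg j z α) α := by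
  have h : lerchNeg (j + 1) z = fun α => (∑ l ∈ Finset.range (j + 1),
      ((j + 1).choose l : ℂ) * polylogNeg l z * α ^ (j + 1 - l)) + polylogNeg (j + 1) z := by
    ext α
    rw [lerchNeg, Finset.sum_range_succ]
    simp
  rw [h, lerchNeg, Finset.mul_sum]
  refine HasDerivAt.add_const _ (HasDerivAt.fun_sum fun l hl => ?_)
  have hl' : l ≤ j := by have := Finset.mem_range.1 hl; omega
  have h1 := (hasDerivAt_pow (j + 1 - l) α).const_mul (((j + 1).choose l : ℂ) * polylogNeg l z)
  have h2 : (j.choose l : ℂ) * (j + 1) = ((j + 1).choose l : ℂ) * ((j + 1 - l : ℕ) : ℂ) := by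
    exact_mod_cast Nat.choose_mul_succ_eq j l
  refine h1.congr_deriv ?_
  rw [show j + 1 - l - 1 = j - l by omega]
  linear_combination -(polylogNeg l z * α ^ (j - l)) * h2

theorem lerchNeg_zero (z α : ℂ) : lerchNeg 0 z α = 1 / (1 - z) := by
  rw [lerchNeg, zero_add, Finset.sum_range_one, polylogNeg]
  simp

/-- By induction, the two sides have the same derivative in `α`. At `α = 0` the identity is
`polylogNeg_relation`. -/
theorem lerchNeg_relation {z : ℂ} (hz : z ≠ 1) (j : ℕ) (α : ℂ) :
    lerchNeg j z α - z * lerchNeg j z (α + 1) = α ^ j := by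
  induction j generalizing α with
  | zero =>
    have h1 : 1 - z ≠ 0 := sub_ne_zero.2 hz.symm
    rw [lerchNeg_zero, lerchNeg_zero]
    field_simp
  | succ j ih =>
    have hd : ∀ α : ℂ, HasDerivAt (fun α => lerchNeg (j + 1) z α - z * lerchNeg (j + 1) z (α + 1) -
        α ^ (j + 1)) 0 α := by
      intro α
      have h1 := ((hasDerivAt_lerchNeg j z α).sub
        (((hasDerivAt_lerchNeg j z (α + 1)).comp_add_const α 1).const_mul z)).sub
        (hasDerivAt_pow (j + 1) α)
      refine h1.congr_deriv ?_
      push_cast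
      linear_combination ((j : ℂ) + 1) * ih α
    have h2 := is_const_of_deriv_eq_zero (fun α => (hd α).differentiableAt)
      (fun α => (hd α).deriv) α 0
    have h3 := polylogNeg_relation (j + 1) hz
    have h4 : lerchNeg (j + 1) z 0 = polylogNeg (j + 1) z := by
      rw [lerchNeg, Finset.sum_range_succ, Finset.sum_eq_zero]
      · simp
      · intro l hl
        have := Finset.mem_range.1 hl
        rw [zero_pow (by omega), mul_zero]
    have h5 : lerchNeg (j + 1) z 1 = ∑ l ∈ Finset.range (j + 1 + 1),
        ((j + 1).choose l : ℂ) * polylogNeg l z := by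
      simp [lerchNeg]
    simp only [zero_add, h4, h5] at h2
    linear_combination h2 + h3

theorem lerchSeries_neg_natCast {z : ℂ} (hz : ‖z‖ < 1) (j : ℕ) (α : ℂ) :
    lerchSeries z (-(j : ℂ)) α = lerchNeg j z α := by
  rw [lerchSeries, lerchNeg]
  refine HasSum.tsum_eq ?_
  have h := hasSum_sum (f := fun (l : ℕ) (n : ℕ) => (j.choose l : ℂ) * α ^ (j - l) *
    ((n : ℂ) ^ l * z ^ n)) (s := Finset.range (j + 1))
    (fun l _ => (hasSum_polylogNeg hz l).mul_left ((j.choose l : ℂ) * α ^ (j - l)))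
  convert h using 1
  · ext n
    rw [Complex.cpow_neg, Complex.cpow_natCast, div_inv_eq_mul, add_pow, Finset.mul_sum]
    refine Finset.sum_congr rfl fun l _ => by ring
  · refine Finset.sum_congr rfl fun l _ => by ring

theorem isLerchContinuation_lerchNeg (j : ℕ) (α : ℂ) :
    IsLerchContinuation {1}ᶜ (-(j : ℂ)) α (fun z => lerchNeg j z α) := by
  refine ⟨DifferentiableOn.analyticOnNhd ?_ isOpen_compl_singleton, fun z hz =>
    (lerchSeries_neg_natCast hz j α).symm⟩
  simp only [lerchNeg]
  exact DifferentiableOn.fun_sum fun l _ =>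
    ((differentiableOn_polylogNeg l).const_mul _).mul_const _

theorem lerchPhi_neg_natCast {z : ℂ} (hz : z ≠ 1) (j : ℕ) (α : ℂ) :
    lerchPhi z (-(j : ℂ)) α = lerchNeg j z α :=
  lerchPhi_eq_of_isLerchContinuation_compl (isLerchContinuation_lerchNeg j α) hz

/-! ### The case of a natural number `k`. -/

theorem rayDir_re (z : ℂ) : (rayDir z).re = 1 := by
  rw [rayDir]; split_ifs <;> simp

theorem norm_rayDir_le (z : ℂ) : ‖rayDir z‖ ≤ 2 := by
  rw [rayDir]
  split_ifs
  · exact (norm_add_le _ _).trans (by simp; norm_num)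
  · exact (norm_sub_le _ _).trans (by simp; norm_num)

theorem exists_norm_pow_mul_exp_le (j : ℕ) {z d : ℂ} (hd : d.re = 1) (hd2 : ‖d‖ ≤ 2) :
    ∃ C : ℝ, ∀ x : ℝ, 0 ≤ x → ‖(z + x * d) ^ j * Complex.exp (-(z + x * d))‖ ≤
      C * Real.exp (-(1 / 2) * x) := by
  refine ⟨(j.factorial : ℝ) * 4 ^ j * Real.exp (‖z‖ / 4) * Real.exp (-z.re), fun x hx => ?_⟩
  have h1 : ‖z + x * d‖ ≤ ‖z‖ + 2 * x := by
    refine (norm_add_le _ _).trans ?_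
    rw [norm_mul, Complex.norm_real, Real.norm_of_nonneg hx]
    nlinarith
  have h2 : ‖z + x * d‖ ^ j ≤ j.factorial * 4 ^ j * Real.exp (‖z‖ / 4 + x / 2) := by
    have h3 := Real.pow_div_factorial_le_exp (‖z + x * d‖ / 4) (by positivity) j
    rw [div_pow, div_div, div_le_iff₀ (by positivity)] at h3
    have h4 : Real.exp (‖z + x * d‖ / 4) ≤ Real.exp (‖z‖ / 4 + x / 2) := by
      gcongr; linarith
    calc _ ≤ Real.exp (‖z + x * d‖ / 4) * (4 ^ j * j.factorial) := h3
      _ ≤ Real.exp (‖z‖ / 4 + x / 2) * (4 ^ j * j.factorial) := by gcongr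
      _ = _ := by ring
  rw [norm_mul, norm_pow, Complex.norm_exp]
  have h5 : (-(z + x * d)).re = -z.re + -x := by simp [hd]; ring
  rw [h5, Real.exp_add]
  calc _ ≤ (j.factorial * 4 ^ j * Real.exp (‖z‖ / 4 + x / 2)) *
        (Real.exp (-z.re) * Real.exp (-x)) := by gcongr
    _ = _ := by
      rw [Real.exp_add, show -(1 / 2) * x = x / 2 + -x by ring, Real.exp_add]
      ring

theorem integrableOn_pow_mul_exp (j : ℕ) {z d : ℂ} (hd : d.re = 1) (hd2 : ‖d‖ ≤ 2) :
    IntegrableOn (fun x : ℝ => (z + x * d) ^ j * Complex.exp (-(z + x * d))) (Set.Ioi 0) := by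
  obtain ⟨C, hC⟩ := exists_norm_pow_mul_exp_le j (z := z) hd hd2
  refine integrableOn_ray (g := fun t => t ^ j * Complex.exp (-t)) (C := C) (σ := 0)
    (δ := 1 / 2) (by norm_num) (by norm_num) (fun x hx => by fun_prop) (fun x hx => ?_)
  rw [Real.rpow_zero, one_mul]
  exact hC x hx.le

theorem tendsto_pow_mul_exp_atTop (j : ℕ) {z d : ℂ} (hd : d.re = 1) (hd2 : ‖d‖ ≤ 2) :
    Tendsto (fun x : ℝ => (z + x * d) ^ j * Complex.exp (-(z + x * d))) atTop (𝓝 0) := by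
  obtain ⟨C, hC⟩ := exists_norm_pow_mul_exp_le j (z := z) hd hd2
  have h1 : Tendsto (fun x : ℝ => C * Real.exp (-(1 / 2) * x)) atTop (𝓝 (C * 0)) := by
    refine Tendsto.const_mul _ (Real.tendsto_exp_atBot.comp ?_)
    exact tendsto_id.const_mul_atTop_of_neg (by norm_num)
  rw [mul_zero] at h1
  refine squeeze_zero_norm' ?_ h1
  filter_upwards [eventually_ge_atTop 0] with x hx using hC x hx

theorem hasDerivAt_add_ofReal_mul (z d : ℂ) (x : ℝ) :
    HasDerivAt (fun x : ℝ => z + x * d) d x := by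
  simpa using ((Complex.ofRealCLM.hasDerivAt (x := x)).mul_const d).const_add z

theorem upperIncompleteGamma_natCast_add_one (j : ℕ) (z : ℂ) :
    upperIncompleteGamma (1 + j) z =
      ∫ x in Set.Ioi (0 : ℝ), (z + x * rayDir z) ^ j * Complex.exp (-(z + x * rayDir z)) *
        rayDir z := by
  simp only [upperIncompleteGamma, add_sub_cancel_left, Complex.cpow_natCast]

theorem upperIncompleteGamma_one (z : ℂ) :
    upperIncompleteGamma (1 + (0 : ℕ)) z = Complex.exp (-z) := by
  rw [upperIncompleteGamma_natCast_add_one]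
  set d := rayDir z
  have h := integral_Ioi_of_hasDerivAt_of_tendsto' (a := 0) (m := 0)
    (f := fun x : ℝ => -Complex.exp (-(z + x * d)))
    (f' := fun x : ℝ => (z + x * d) ^ 0 * Complex.exp (-(z + x * d)) * d) (fun x _ => ?_)
    ((integrableOn_pow_mul_exp 0 (rayDir_re z) (norm_rayDir_le z)).mul_const d) ?_
  · rw [h]; simp
  · refine ((hasDerivAt_add_ofReal_mul z d x).fun_neg.cexp).fun_neg.congr_deriv ?_
    ring
  · simpa using (tendsto_pow_mul_exp_atTop 0 (z := z) (rayDir_re z) (norm_rayDir_le z)).neg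

/-- Integration by parts along the ray. With natural exponents the powers are entire, so no branch
question arises. -/
theorem upperIncompleteGamma_succ (j : ℕ) (z : ℂ) :
    upperIncompleteGamma (1 + (j + 1 : ℕ)) z =
      (j + 1) * upperIncompleteGamma (1 + j) z + z ^ (j + 1) * Complex.exp (-z) := by
  rw [upperIncompleteGamma_natCast_add_one, upperIncompleteGamma_natCast_add_one]
  set d := rayDir z
  have hi0 := (integrableOn_pow_mul_exp j (z := z) (rayDir_re z) (norm_rayDir_le z)).mul_const d
  have hi1 := (integrableOn_pow_mul_exp (j + 1) (z := z) (rayDir_re z)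
    (norm_rayDir_le z)).mul_const d
  have h := integral_Ioi_of_hasDerivAt_of_tendsto' (a := 0) (m := 0)
    (f := fun x : ℝ => -((z + x * d) ^ (j + 1) * Complex.exp (-(z + x * d))))
    (f' := fun x : ℝ => (z + x * d) ^ (j + 1) * Complex.exp (-(z + x * d)) * d -
      (j + 1) * ((z + x * d) ^ j * Complex.exp (-(z + x * d)) * d)) (fun x _ => ?_)
    (hi1.sub (hi0.const_mul _)) ?_
  · rw [integral_sub hi1 (hi0.const_mul _), integral_const_mul] at h
    simp only [Complex.ofReal_zero, zero_mul, add_zero] at h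
    linear_combination h
  · refine (((hasDerivAt_add_ofReal_mul z d x).fun_pow (j + 1)).fun_mul
      (hasDerivAt_add_ofReal_mul z d x).fun_neg.cexp).fun_neg.congr_deriv ?_
    push_cast
    ring
  · simpa using (tendsto_pow_mul_exp_atTop (j + 1) (z := z) (rayDir_re z)
      (norm_rayDir_le z)).neg

theorem bilateralTerm_eq {a : ℂ} (ha : a ≠ 0) (k m : ℂ) (β : ℝ) (n : ℤ) :
    bilateralTerm a k m β n = Complex.exp (Complex.I * n * β) *
      (Complex.exp (((n : ℂ) - m) * Complex.log a) *
        upperIncompleteGamma (1 + k) (((n : ℂ) - m) * Complex.log a) / ((n : ℂ) - m) ^ (k + 1)) := by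
  rw [bilateralTerm, Complex.cpow_def_of_ne_zero ha, mul_comm (Complex.log a)]
  ring

/-- Both sides obey the same recursion in `j`: on the left that of the incomplete gamma function, on
the right integration by parts. The boundary terms at `0` and `2π` combine through the shift
identity, because `e^{-2πiw} = z` and moving `y` by `2π` moves `α` by `1`. -/
theorem exp_mul_upperIncompleteGamma_div_eq_integral {j : ℕ} {L w z : ℂ} (hw : w ≠ 0)
    (hz : z ≠ 1) (hzw : Complex.exp (-(Complex.I * w * (2 * Real.pi))) = z) :
    Complex.exp (w * L) * upperIncompleteGamma (1 + j) (w * L) / w ^ (j + 1) =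
      Complex.I ^ (j + 1) * ∫ y in Set.Ioc 0 (2 * Real.pi),
        (2 * Real.pi : ℂ) ^ j * lerchNeg j z ((y - Complex.I * L) / (2 * Real.pi)) *
          Complex.exp (-(Complex.I * w * y)) := by
  have hI := Complex.I_ne_zero
  have hsq := Complex.I_sq
  set Q : ℕ → ℝ → ℂ := fun j y =>
    (2 * Real.pi : ℂ) ^ j * lerchNeg j z ((y - Complex.I * L) / (2 * Real.pi)) with hQ
  have hQ' : ∀ (j : ℕ) (y : ℝ), HasDerivAt (Q (j + 1)) ((j + 1) * Q j y) y := by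
    intro j y
    have h1 : HasDerivAt (fun y : ℝ => ((y : ℂ) - Complex.I * L) / (2 * Real.pi))
        (1 / (2 * Real.pi)) y := by
      simpa using (((Complex.ofRealCLM.hasDerivAt (x := y)).sub_const (Complex.I * L)).div_const
        (2 * Real.pi : ℂ))
    refine (((hasDerivAt_lerchNeg j z _).scomp y h1).const_mul
      ((2 * Real.pi : ℂ) ^ (j + 1))).congr_deriv ?_
    simp only [hQ, smul_eq_mul]
    rw [pow_succ]
    field_simp
  have hexp : ∀ y : ℝ, HasDerivAt (fun y : ℝ => Complex.exp (-(Complex.I * w * y)))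
      (Complex.exp (-(Complex.I * w * y)) * -(Complex.I * w)) y := by
    intro y
    refine HasDerivAt.cexp ?_
    simpa using ((Complex.ofRealCLM.hasDerivAt (x := y)).const_mul (Complex.I * w)).fun_neg
  have hQc : ∀ j, Continuous (Q j) := by
    intro j
    rcases j with _ | j
    · have : Q 0 = fun _ => 1 / (1 - z) := by ext y; simp [hQ, lerchNeg_zero]
      rw [this]; exact continuous_const
    · exact continuous_iff_continuousAt.2 fun y => (hQ' j y).continuousAt
  have hIw : Complex.I * w ≠ 0 := mul_ne_zero hI hw
  rw [← intervalIntegral.integral_of_le (by positivity)]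
  change _ = Complex.I ^ (j + 1) * ∫ y in (0 : ℝ)..(2 * Real.pi),
    Q j y * Complex.exp (-(Complex.I * w * y))
  induction j with
  | zero =>
    have hQ0 : ∀ y, Q 0 y = 1 / (1 - z) := by intro y; simp [hQ, lerchNeg_zero]
    have h := intervalIntegral.integral_eq_sub_of_hasDerivAt (a := 0) (b := 2 * Real.pi)
      (fun y _ => hexp y) (Continuous.intervalIntegrable (by fun_prop) _ _)
    rw [intervalIntegral.integral_mul_const] at h
    simp_rw [hQ0]
    rw [intervalIntegral.integral_const_mul, upperIncompleteGamma_one]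
    push_cast at h
    rw [hzw] at h
    simp only [mul_zero, neg_zero, Complex.exp_zero] at h
    have h2 : ∫ y in (0 : ℝ)..(2 * Real.pi), Complex.exp (-(Complex.I * w * y)) =
        (1 - z) / (Complex.I * w) := by
      rw [eq_div_iff hIw]
      linear_combination -h
    rw [h2, ← Complex.exp_add, add_neg_cancel, Complex.exp_zero]
    field_simp
    ring
  | succ j ih =>
    have hd : ∀ y : ℝ, HasDerivAt (fun y : ℝ => Q (j + 1) y * Complex.exp (-(Complex.I * w * y)))
        ((j + 1) * (Q j y * Complex.exp (-(Complex.I * w * y))) -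
          Complex.I * w * (Q (j + 1) y * Complex.exp (-(Complex.I * w * y)))) y := by
      intro y
      refine ((hQ' j y).fun_mul (hexp y)).congr_deriv ?_
      ring
    have h := intervalIntegral.integral_eq_sub_of_hasDerivAt (a := 0) (b := 2 * Real.pi)
      (fun y _ => hd y) (Continuous.intervalIntegrable (by fun_prop) _ _)
    rw [intervalIntegral.integral_sub
      (Continuous.intervalIntegrable (by fun_prop) _ _)
      (Continuous.intervalIntegrable (by fun_prop) _ _),
      intervalIntegral.integral_const_mul, intervalIntegral.integral_const_mul] at h
    -- The boundary contribution, which matches `z ^ (j + 1) * exp (-z)` of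
    -- `upperIncompleteGamma_succ` at `z = w * L`.
    have hQb : Q (j + 1) 0 - z * Q (j + 1) (2 * Real.pi) = (-(Complex.I * L)) ^ (j + 1) := by
      have h1 := lerchNeg_relation hz (j + 1) ((0 - Complex.I * L) / (2 * Real.pi))
      have h2 : (((2 * Real.pi : ℝ) : ℂ) - Complex.I * L) / (2 * Real.pi) =
          (0 - Complex.I * L) / (2 * Real.pi) + 1 := by
        push_cast; field_simp; ring
      simp only [hQ, h2, Complex.ofReal_zero]
      calc _ = (2 * Real.pi : ℂ) ^ (j + 1) * (((0 - Complex.I * L) / (2 * Real.pi)) ^ (j + 1)) := by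
            rw [← h1]; ring
        _ = _ := by
          rw [← mul_pow]
          congr 1
          field_simp
          ring
    push_cast at h
    rw [hzw] at h
    simp only [mul_zero, neg_zero, Complex.exp_zero, mul_one] at h
    set A := ∫ y in (0 : ℝ)..(2 * Real.pi), Q j y * Complex.exp (-(Complex.I * w * y))
    set B := ∫ y in (0 : ℝ)..(2 * Real.pi), Q (j + 1) y * Complex.exp (-(Complex.I * w * y))
    have hB : B = ((-(Complex.I * L)) ^ (j + 1) + (j + 1) * A) / (Complex.I * w) := by
      rw [eq_div_iff hIw, ← hQb]
      linear_combination -h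
    rw [hB, upperIncompleteGamma_succ, mul_add, ← mul_assoc,
      mul_comm (Complex.exp (w * L)) ((j : ℂ) + 1), mul_assoc, mul_comm ((w * L) ^ (j + 1)),
      ← mul_assoc (Complex.exp (w * L)) (Complex.exp (-(w * L))), ← Complex.exp_add,
      add_neg_cancel, Complex.exp_zero, one_mul]
    have h3 : Complex.exp (w * L) * upperIncompleteGamma (1 + j) (w * L) =
        Complex.I ^ (j + 1) * A * w ^ (j + 1) := by
      rw [← ih, div_mul_cancel₀ _ (pow_ne_zero _ hw)]
    rw [h3, mul_pow]
    have h4 : Complex.I ^ (j + 1) * (-(Complex.I * L)) ^ (j + 1) = L ^ (j + 1) := by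
      rw [← mul_pow]
      congr 1
      linear_combination (-L) * hsq
    rw [pow_succ Complex.I (j + 1), pow_succ w (j + 1)]
    field_simp
    linear_combination -h4

theorem exp_two_pi_I_mul_ne_one {m : ℂ} (hm : ∀ n : ℤ, m ≠ n) :
    Complex.exp (2 * Complex.I * m * Real.pi) ≠ 1 := by
  intro h
  obtain ⟨n, hn⟩ := Complex.exp_eq_one_iff.1 h
  apply hm n
  have hpi : (Real.pi : ℂ) ≠ 0 := by exact_mod_cast Real.pi_ne_zero
  have h2 : (2 * Complex.I * Real.pi) * (m - n) = 0 := by linear_combination hn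
  rcases mul_eq_zero.1 h2 with h3 | h3
  · simp [hpi] at h3
  · exact sub_eq_zero.1 h3

theorem tendsto_sum_bilateralTerm_natCast {a m : ℂ} {β : ℝ} (j : ℕ) (ha : a ≠ 0)
    (hβ0 : 0 < β) (hβ1 : β < 2 * Real.pi) (hm : ∀ n : ℤ, m ≠ n) :
    Tendsto (fun N : ℕ × ℕ => ∑ n ∈ Finset.Icc (-(N.1 : ℤ)) (N.2 : ℤ), bilateralTerm a j m β n)
      atTop
      (𝓝 (Complex.I * Complex.exp (Complex.I * (j * Real.pi + 2 * m * β) / 2) *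
        (2 * Real.pi : ℂ) ^ (1 + (j : ℂ)) *
        lerchPhi (Complex.exp (2 * Complex.I * m * Real.pi)) (-j)
          ((β - Complex.I * Complex.log a) / (2 * Real.pi)))) := by
  set z := Complex.exp (2 * Complex.I * m * Real.pi) with hz
  have hz1 : z ≠ 1 := exp_two_pi_I_mul_ne_one hm
  set L := Complex.log a
  set G : ℝ → ℂ := fun y => (2 * Real.pi : ℂ) ^ j *
    lerchNeg j z ((y - Complex.I * L) / (2 * Real.pi)) * Complex.exp (Complex.I * m * y) with hG
  have hGd : Differentiable ℝ G := by
    intro y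
    simp only [hG, lerchNeg]
    have : DifferentiableAt ℝ (fun y : ℝ => (y : ℂ)) y := Complex.ofRealCLM.differentiableAt
    fun_prop
  have h := (tendsto_sum_integral_mul_exp hβ0 hβ1
    (hGd.continuous.integrableOn_Ioc) (hGd β)).const_mul (Complex.I ^ (j + 1))
  convert h using 1
  · ext N
    rw [Finset.mul_sum]
    refine Finset.sum_congr rfl fun n _ => ?_
    have hw : (n : ℂ) - m ≠ 0 := sub_ne_zero.2 (hm n).symm
    -- The same `z` for every `n`, so one function `G` provides all the coefficients.
    have hzw : Complex.exp (-(Complex.I * (n - m) * (2 * Real.pi))) = z := by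
      rw [hz, Complex.exp_eq_exp_iff_exists_int]
      exact ⟨-n, by push_cast; ring⟩
    have h2 := exp_mul_upperIncompleteGamma_div_eq_integral (j := j) (L := L) hw hz1 hzw
    have h3 : ((n : ℂ) - m) ^ ((j : ℂ) + 1) = ((n : ℂ) - m) ^ (j + 1) := by
      rw [← Complex.cpow_natCast]; push_cast; rfl
    rw [bilateralTerm_eq ha, h3, h2, mul_left_comm, ← integral_const_mul]
    congr 1
    refine integral_congr_ae (Eventually.of_forall fun y => ?_)
    simp only [hG]
    have h4 : Complex.exp (Complex.I * n * (β - y)) = Complex.exp (Complex.I * n * β) *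
        Complex.exp (-(Complex.I * (n - m) * y)) * Complex.exp (-(Complex.I * m * y)) := by
      rw [← Complex.exp_add, ← Complex.exp_add]; congr 1; ring
    have h5 : Complex.exp (-(Complex.I * m * y)) * Complex.exp (Complex.I * m * y) = 1 := by
      rw [← Complex.exp_add, neg_add_cancel, Complex.exp_zero]
    rw [h4]
    linear_combination -((2 * Real.pi : ℂ) ^ j * lerchNeg j z ((y - Complex.I * L) / (2 * Real.pi)) *
      Complex.exp (Complex.I * n * β) * Complex.exp (-(Complex.I * (n - m) * y))) * h5
  · congr 1
    rw [lerchPhi_neg_natCast hz1]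
    simp only [hG]
    have h1 : Complex.exp (Complex.I * (j * Real.pi + 2 * m * β) / 2) =
        Complex.I ^ j * Complex.exp (Complex.I * m * β) := by
      have h0 : Complex.I ^ j = Complex.exp (j * (Real.pi / 2 * Complex.I)) := by
        rw [Complex.exp_nat_mul, Complex.exp_pi_div_two_mul_I]
      rw [h0, ← Complex.exp_add]
      congr 1; ring
    have h2 : (2 * Real.pi : ℂ) ^ (1 + (j : ℂ)) = 2 * Real.pi * (2 * Real.pi) ^ j := by
      have : (1 + (j : ℂ)) = ((1 + j : ℕ) : ℂ) := by push_cast; rfl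
      rw [this, Complex.cpow_natCast, pow_add, pow_one]
    rw [h1, h2]
    ring

/-! ### Folding a half-line integral modulo `2π`. -/

theorem hasSum_integral_Ioc_add {h : ℝ → ℂ} {T : ℝ} (hT : 0 < T) (hh : IntegrableOn h (Set.Ioi 0)) :
    HasSum (fun p : ℕ => ∫ y in Set.Ioc 0 T, h (y + T * p)) (∫ y in Set.Ioi 0, h y) := by
  have hmono : Monotone (fun p : ℕ => T * (p : ℝ)) := fun p q hpq => by
    have : (p : ℝ) ≤ q := by exact_mod_cast hpq
    simp only; gcongr
  have hU : ⋃ p : ℕ, Set.Ioc (T * (p : ℝ)) (T * ((Order.succ p : ℕ) : ℝ)) = Set.Ioi 0 := by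
    have := iUnion_Ioc_map_succ_eq_Ioi (f := fun p : ℕ => T * (p : ℝ))
      (fun p => hmono bot_le) ?_
    · simpa using this
    · rintro ⟨b, hb⟩
      obtain ⟨n, hn⟩ := exists_nat_gt (b / T)
      have h1 : T * (n : ℝ) ≤ b := hb ⟨n, rfl⟩
      rw [div_lt_iff₀ hT] at hn
      linarith
  have h1 := hasSum_integral_iUnion (f := h) (μ := volume)
    (s := fun p : ℕ => Set.Ioc (T * (p : ℝ)) (T * ((Order.succ p : ℕ) : ℝ)))
    (fun _ => measurableSet_Ioc) hmono.pairwise_disjoint_on_Ioc_succ (by rwa [hU])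
  rw [hU] at h1
  refine h1.congr_fun fun p => ?_
  rw [← intervalIntegral.integral_of_le hT.le, ← intervalIntegral.integral_of_le (hmono (Order.le_succ p)),
    intervalIntegral.integral_comp_add_right h]
  congr 1
  · ring
  · simp; ring

theorem integrableOn_Ioc_comp_add {E : Type*} [NormedAddCommGroup E] {h : ℝ → E} {T : ℝ}
    (hT : 0 < T) (hh : IntegrableOn h (Set.Ioi 0)) (p : ℕ) :
    IntegrableOn (fun y => h (y + T * p)) (Set.Ioc 0 T) := by
  have h1 : IntervalIntegrable h volume (0 + T * p) (T + T * p) := by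
    rw [intervalIntegrable_iff_integrableOn_Ioc_of_le (by linarith)]
    refine hh.mono_set fun y hy => ?_
    have : 0 ≤ T * p := by positivity
    exact lt_of_le_of_lt (by linarith) hy.1
  have h2 := h1.comp_add_right (T * p)
  rw [add_sub_cancel_right, add_sub_cancel_right] at h2
  exact (intervalIntegrable_iff_integrableOn_Ioc_of_le hT.le).1 h2

theorem integral_Ioi_eq_integral_periodization {f G : ℝ → ℂ} (hf : IntegrableOn f (Set.Ioi 0))
    (hG : ∀ y ∈ Set.Ioc 0 (2 * Real.pi), HasSum (fun p : ℕ => f (y + 2 * Real.pi * p)) (G y))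
    (β : ℝ) (n : ℤ) :
    ∫ y in Set.Ioi 0, f y * Complex.exp (Complex.I * n * (β - y)) =
      ∫ y in Set.Ioc 0 (2 * Real.pi), G y * Complex.exp (Complex.I * n * (β - y)) := by
  have hT : 0 < 2 * Real.pi := by positivity
  have hbdd : ∀ s : Set ℝ, ∀ f : ℝ → ℂ, IntegrableOn f s →
      IntegrableOn (fun y : ℝ => f y * Complex.exp (Complex.I * n * (β - y))) s := by
    intro s f hf
    refine hf.mul_bdd (c := 1) (Continuous.aestronglyMeasurable (by fun_prop))
      (Eventually.of_forall fun y => ?_)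
    have : Complex.I * n * (β - y) = ((n * (β - y) : ℝ) : ℂ) * Complex.I := by push_cast; ring
    rw [this, Complex.norm_exp_ofReal_mul_I]
  have h1 := hasSum_integral_Ioc_add hT (hbdd _ f hf)
  have hper : ∀ (y : ℝ) (p : ℕ), Complex.exp (Complex.I * n * (β - ((y + 2 * Real.pi * p : ℝ) : ℂ))) =
      Complex.exp (Complex.I * n * (β - y)) := by
    intro y p
    rw [Complex.exp_eq_exp_iff_exists_int]
    exact ⟨-(n * p), by push_cast; ring⟩
  simp_rw [hper] at h1
  have hnorm := (hasSum_integral_Ioc_add (h := fun y => ((‖f y‖ : ℝ) : ℂ)) hT hf.norm.ofReal).summable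
  have h2 := hasSum_integral_of_summable_integral_norm
    (F := fun (p : ℕ) (y : ℝ) => f (y + 2 * Real.pi * p) * Complex.exp (Complex.I * n * (β - y)))
    (μ := volume.restrict (Set.Ioc 0 (2 * Real.pi)))
    (fun p => hbdd _ _ (integrableOn_Ioc_comp_add hT hf p)) ?_
  · rw [h1.unique h2]
    refine setIntegral_congr_fun measurableSet_Ioc fun y hy => ?_
    exact ((hG y hy).mul_right _).tsum_eq
  · have hnorm1 : ∀ y : ℝ, ‖Complex.exp (Complex.I * n * (β - y))‖ = 1 := fun y => by
      have : Complex.I * n * (β - y) = ((n * (β - y) : ℝ) : ℂ) * Complex.I := by push_cast; ring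
      rw [this, Complex.norm_exp_ofReal_mul_I]
    simp_rw [norm_mul, hnorm1, mul_one]
    rw [← Complex.summable_ofReal]
    refine hnorm.congr fun p => ?_
    exact integral_complex_ofReal

/-! ### The incomplete gamma function as a vertical ray integral. -/

/-- The arguments lie in `(-π, 0)` and `[0, π]`, so their sum lies in `(-π, π)`. -/
theorem mul_mem_slitPlane_of_im_neg {w s : ℂ} (hw : w.im < 0) (hs : 0 ≤ s.im) (hs0 : s ≠ 0) :
    w * s ∈ Complex.slitPlane := by
  rw [Complex.mem_slitPlane_iff]
  by_contra h
  push Not at h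
  simp only [Complex.mul_re, Complex.mul_im] at h
  obtain ⟨h1, h2⟩ := h
  have h3 : (w.re ^ 2 + w.im ^ 2) * s.im = -w.im * (w.re * s.re - w.im * s.im) := by
    linear_combination w.re * h2
  have h5 : 0 < w.re ^ 2 + w.im ^ 2 := by nlinarith [sq_nonneg w.re]
  have h6 : s.im = 0 := by
    by_contra h0
    have : 0 < s.im := lt_of_le_of_ne hs (Ne.symm h0)
    nlinarith
  rw [h6, mul_zero, zero_add] at h2
  rcases mul_eq_zero.1 h2 with h7 | h7
  · exact absurd h7 hw.ne
  · exact hs0 (Complex.ext h7 h6)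

/-- Coordinate form of the next lemma for a start `p + iq` in the closed upper half-plane. If a
point pushed by `a (1 + i)`, `a > 0`, fell on the cut, the unpushed ray would already have met the
real axis at the smaller parameter `q / -v`, further to the left, contradicting `h`. -/
theorem re_pos_or_im_ne_zero_of_ray {p q u v : ℝ} (hu : 0 < u) (hq : 0 ≤ q)
    (h₀ : 0 < p ∨ q ≠ 0 ∨ p = 0) (h : ∀ b : ℝ, 0 < b → 0 < p + b * u ∨ q + b * v ≠ 0)
    {a b : ℝ} (ha : 0 ≤ a) (hb : 0 ≤ b) (hab : 0 < a + b) :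
    0 < p + a + b * u ∨ q + a + b * v ≠ 0 := by
  by_contra hcon
  push Not at hcon
  obtain ⟨h1, h2⟩ := hcon
  rcases ha.eq_or_lt with rfl | ha
  · rcases h b (by linarith) with h3 | h3
    · linarith
    · exact h3 (by linarith)
  · have hbv : b * v < 0 := by linarith
    have hb0 : 0 < b := lt_of_le_of_ne hb (by rintro rfl; simp at hbv)
    have hv : v < 0 := by
      by_contra hv
      have := mul_nonneg hb (not_lt.1 hv)
      linarith
    have hbu : 0 < b * u := by positivity
    rcases hq.eq_or_lt with rfl | hq
    · rcases h₀ with h | h | h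
      · linarith
      · exact h rfl
      · linarith
    · have hb1 : q / -v < b := by
        rw [div_lt_iff₀ (by linarith)]
        linarith
      rcases h (q / -v) (div_pos hq (by linarith)) with h3 | h3
      · have : q / -v * u < b * u := by gcongr
        linarith
      · apply h3
        rw [div_neg, neg_mul, div_mul_cancel₀ _ hv.ne, add_neg_cancel]

theorem add_rayDir_mem_slitPlane {z d : ℂ} (hd : 0 < d.re) (hz : z ∈ Complex.slitPlane ∨ z = 0)
    (h : ∀ b : ℝ, 0 < b → z + b * d ∈ Complex.slitPlane) {a b : ℝ} (ha : 0 ≤ a) (hb : 0 ≤ b)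
    (hab : 0 < a + b) : z + a * rayDir z + b * d ∈ Complex.slitPlane := by
  simp only [Complex.mem_slitPlane_iff, Complex.add_re, Complex.add_im, Complex.re_ofReal_mul,
    Complex.im_ofReal_mul] at h ⊢
  have h₀ : 0 < z.re ∨ z.im ≠ 0 ∨ z.re = 0 := by
    rcases hz with hz | rfl
    · rw [Complex.mem_slitPlane_iff] at hz
      tauto
    · simp
  rw [rayDir]
  split_ifs with him
  · simpa using re_pos_or_im_ne_zero_of_ray hd him h₀ h ha hb hab
  · have := re_pos_or_im_ne_zero_of_ray (p := z.re) (q := -z.im) (u := d.re) (v := -d.im) hd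
      (by linarith) (by rwa [neg_ne_zero]) (fun b hb => (h b hb).imp_right fun h0 h1 => h0 (by linarith))
      ha hb hab
    refine this.imp (fun h0 => by simpa using h0) fun h0 h1 => h0 ?_
    simp only [Complex.sub_im, Complex.one_im, Complex.I_im] at h1
    linarith

theorem mul_cpow_of_arg_add {x y : ℂ} (hx : x ≠ 0) (hy : y ≠ 0)
    (h : x.arg + y.arg ∈ Set.Ioc (-Real.pi) Real.pi) (k : ℂ) : (x * y) ^ k = x ^ k * y ^ k := by
  rw [Complex.cpow_def_of_ne_zero (mul_ne_zero hx hy), Complex.cpow_def_of_ne_zero hx,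
    Complex.cpow_def_of_ne_zero hy, (Complex.log_mul_eq_add_log_iff hx hy).2 h, add_mul,
    Complex.exp_add]

/-- Turn the defining ray at `w * L` to the direction `w * I`, then substitute `t ↦ w t`. The power
splits because `arg w ∈ (-π, 0)`, while the ray from `L` upwards has arguments in `[0, π]`. -/
theorem upperIncompleteGamma_mul_eq_rayIntegral {k w L : ℂ} (hw : w.im < 0) (hL : 0 ≤ L.im)
    (hk : L ≠ 0 ∨ -1 < k.re) :
    upperIncompleteGamma (1 + k) (w * L) = w ^ (k + 1) * rayIntegral k w L Complex.I := by
  have hw0 : w ≠ 0 := by rintro rfl; simp at hw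
  have hd : 0 < (w * Complex.I).re := by simpa using hw
  have him : ∀ b : ℝ, 0 < b → 0 < (L + b * Complex.I).im := fun b hb => by simp; linarith
  have hne : ∀ b : ℝ, 0 < b → L + b * Complex.I ≠ 0 := fun b hb h0 => by
    have := him b hb; rw [h0] at this; simp at this
  rw [upperIncompleteGamma_eq_rayIntegral, add_sub_cancel_left,
    rayIntegral_rotate (d₂ := w * Complex.I) (by simp [rayDir_re]) (by simpa using hw) ?_ ?_]
  · refine rayIntegral_scale hw0 fun x hx => mul_cpow_of_arg_add hw0 (hne x hx) ?_ k
    have h1 := Complex.arg_neg_iff.2 hw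
    have h2 := Complex.neg_pi_lt_arg w
    have h3 := Complex.arg_nonneg_iff.2 (him x hx).le
    have h4 := Complex.arg_le_pi (L + x * Complex.I)
    exact ⟨by linarith, by linarith⟩
  · intro a b ha hb hab
    refine add_rayDir_mem_slitPlane hd ?_ (fun b hb => ?_) ha hb hab
    · rcases eq_or_ne L 0 with rfl | h0
      · right; simp
      · exact Or.inl (mul_mem_slitPlane_of_im_neg hw hL h0)
    · have : w * L + b * (w * Complex.I) = w * (L + b * Complex.I) := by ring
      rw [this]
      exact mul_mem_slitPlane_of_im_neg hw (him b hb).le (hne b hb)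
  · exact hk.imp_left fun h => mul_ne_zero hw0 h

theorem I_mul_cpow_of_re_pos {s : ℂ} (hs : 0 < s.re) (k : ℂ) :
    (Complex.I * s) ^ k = Complex.exp (Complex.I * (k * Real.pi) / 2) * s ^ k := by
  have hs0 : s ≠ 0 := by rintro rfl; simp at hs
  have h1 := abs_lt.1 (Complex.abs_arg_lt_pi_div_two_iff.2 (Or.inl hs))
  rw [mul_cpow_of_arg_add Complex.I_ne_zero hs0 (by
    rw [Complex.arg_I]; constructor <;> linarith [h1.1, h1.2, Real.pi_pos]),
    Complex.cpow_def_of_ne_zero Complex.I_ne_zero, Complex.log_I]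
  congr 2
  ring

theorem bilateralTerm_eq_rayIntegral {a k m : ℂ} {β : ℝ} (ha : a ≠ 0) (ha1 : a = 1 → -1 < k.re)
    (hm : 0 < m.im) (ha2 : 0 ≤ a.im) (n : ℤ) :
    bilateralTerm a k m β n = Complex.exp (Complex.I * n * β) *
      (Complex.exp (((n : ℂ) - m) * Complex.log a) *
        rayIntegral k ((n : ℂ) - m) (Complex.log a) Complex.I) := by
  have hw : ((n : ℂ) - m).im < 0 := by simpa using hm
  have hw0 : (n : ℂ) - m ≠ 0 := by intro h; rw [h] at hw; simp at hw
  rw [bilateralTerm_eq ha, upperIncompleteGamma_mul_eq_rayIntegral hw]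
  · have : ((n : ℂ) - m) ^ (k + 1) ≠ 0 := (Complex.cpow_ne_zero_iff).2 (Or.inl hw0)
    field_simp
  · rw [Complex.log_im]; exact Complex.arg_nonneg_iff.2 ha2
  · by_cases h1 : a = 1
    · exact Or.inr (ha1 h1)
    · refine Or.inl fun h0 => h1 ?_
      rw [← Complex.exp_log ha, h0, Complex.exp_zero]

/-! ### Poisson summation for `Im m > 0`. -/

/-- The shift by `p + 1` periods keeps the base of the power at distance at least `π` from `0`. The
exponential decays at rate `2π m.im` per period, and the power is allowed to consume half of that.
-/
theorem exists_norm_cpow_mul_exp_translate_le {k m L : ℂ} (hm : 0 < m.im) (hL : 0 ≤ L.im) (R : ℝ) :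
    ∃ C : ℝ, ∀ (p : ℕ) (y : ℂ), -Real.pi < y.re → ‖y‖ < R →
      ‖(y + 2 * Real.pi * (p + 1) - Complex.I * L) ^ k *
        Complex.exp (Complex.I * m * (y + 2 * Real.pi * (p + 1)))‖ ≤
        C * Real.exp (-(Real.pi * m.im)) ^ p := by
  obtain ⟨C, hC0, hC⟩ := exists_norm_cpow_le_exp k Real.pi_pos (ε := m.im / 2) (by positivity)
  refine ⟨C * Real.exp (m.im / 2 * (R + ‖L‖) + R * ‖m‖), fun p y hy hyR => ?_⟩
  have hpi := Real.pi_pos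
  have hp : (0 : ℝ) ≤ p := by positivity
  set s := y + 2 * Real.pi * (p + 1) - Complex.I * L with hs
  have hre : s.re = y.re + 2 * Real.pi * (p + 1) + L.im := by
    have : (2 * Real.pi * (p + 1) : ℂ) = ((2 * Real.pi * (p + 1) : ℝ) : ℂ) := by push_cast; ring
    rw [hs, this]
    simp
  have h1 : Real.pi ≤ ‖s‖ := by
    refine le_trans ?_ (Complex.re_le_norm s)
    rw [hre]
    have := mul_nonneg hpi.le hp
    linarith
  have h2 : ‖s‖ ≤ R + 2 * Real.pi * (p + 1) + ‖L‖ := by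
    have h3 : ‖(2 * Real.pi * (p + 1) : ℂ)‖ = 2 * Real.pi * (p + 1) := by
      have : (2 * Real.pi * (p + 1) : ℂ) = ((2 * Real.pi * (p + 1) : ℝ) : ℂ) := by push_cast; ring
      rw [this, Complex.norm_real, Real.norm_of_nonneg (by positivity)]
    have h4 : ‖Complex.I * L‖ = ‖L‖ := by simp
    have := norm_sub_le (y + 2 * Real.pi * (p + 1)) (Complex.I * L)
    have := norm_add_le y (2 * Real.pi * (p + 1))
    linarith
  have h5 : (Complex.I * m * (y + 2 * Real.pi * (p + 1))).re ≤
      R * ‖m‖ - m.im * (2 * Real.pi * (p + 1)) := by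
    have h6 : (Complex.I * m * (y + 2 * Real.pi * (p + 1))).re =
        (Complex.I * m * y).re - m.im * (2 * Real.pi * (p + 1)) := by
      have : Complex.I * m * (y + 2 * Real.pi * (p + 1)) =
        Complex.I * m * y + ((2 * Real.pi * (p + 1) : ℝ) : ℂ) * (Complex.I * m) := by
        push_cast; ring
      rw [this, Complex.add_re, Complex.re_ofReal_mul]
      simp
      ring
    have h7 := Complex.re_le_norm (Complex.I * m * y)
    rw [norm_mul, norm_mul, Complex.norm_I, one_mul] at h7
    have : ‖m‖ * ‖y‖ ≤ ‖m‖ * R := by gcongr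
    rw [h6]; linarith
  rw [norm_mul, Complex.norm_exp]
  calc ‖s ^ k‖ * Real.exp (Complex.I * m * (y + 2 * Real.pi * (p + 1))).re
      ≤ (C * Real.exp (m.im / 2 * (R + 2 * Real.pi * (p + 1) + ‖L‖))) *
        Real.exp (R * ‖m‖ - m.im * (2 * Real.pi * (p + 1))) := by
        gcongr
        exact (hC s h1).trans (by gcongr)
    _ = C * Real.exp (m.im / 2 * (R + ‖L‖) + R * ‖m‖) * Real.exp (-(Real.pi * m.im) * (p + 1)) := by
        have h8 : Real.exp (m.im / 2 * (R + 2 * Real.pi * (p + 1) + ‖L‖)) *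
            Real.exp (R * ‖m‖ - m.im * (2 * Real.pi * (p + 1))) =
            Real.exp (m.im / 2 * (R + ‖L‖) + R * ‖m‖) * Real.exp (-(Real.pi * m.im) * (p + 1)) := by
          rw [← Real.exp_add, ← Real.exp_add]
          congr 1; ring
        linear_combination C * h8
    _ ≤ _ := by
        have h9 : Real.exp (-(Real.pi * m.im) * (p + 1)) ≤ Real.exp (-(Real.pi * m.im)) ^ p := by
          rw [← Real.exp_nat_mul]
          refine Real.exp_le_exp.2 ?_
          have := mul_pos hpi hm
          linarith
        gcongr

theorem integrableOn_cpow_mul_exp {k m L : ℂ} (hm : 0 < m.im) (hL : 0 ≤ L.im)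
    (hk : L ≠ 0 ∨ -1 < k.re) :
    IntegrableOn (fun y : ℝ => ((y : ℂ) - Complex.I * L) ^ k * Complex.exp (Complex.I * m * y))
      (Set.Ioi 0) := by
  have h := (integrableOn_cpow_mul_exp_ray (κ := k) (w := -(Complex.I * m)) (z := -(Complex.I * L))
    (d := 1) (by simpa using hm) (fun x hx => ?_) (hk.imp_left fun h => ?_)).mul_const
    (Complex.exp (Complex.I * m * (Complex.I * L)))
  · refine h.congr (Eventually.of_forall fun y => ?_)
    simp only
    rw [mul_assoc, ← Complex.exp_add]
    congr 2 <;> ring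
  · rw [Complex.mem_slitPlane_iff]
    left
    simp
    linarith
  · simpa using h

theorem tendsto_sum_bilateralTerm_of_im_pos {a k m : ℂ} {β : ℝ} (ha : a ≠ 0)
    (ha1 : a = 1 → -1 < k.re) (hβ0 : 0 < β) (hβ1 : β < 2 * Real.pi) (hm : 0 < m.im)
    (ha2 : 0 ≤ a.im) :
    Tendsto (fun N : ℕ × ℕ => ∑ n ∈ Finset.Icc (-(N.1 : ℤ)) (N.2 : ℤ), bilateralTerm a k m β n)
      atTop
      (𝓝 (Complex.I * Complex.exp (Complex.I * (k * Real.pi + 2 * m * β) / 2) *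
        (2 * Real.pi : ℂ) ^ (1 + k) *
        lerchPhi (Complex.exp (2 * Complex.I * m * Real.pi)) (-k)
          ((β - Complex.I * Complex.log a) / (2 * Real.pi)))) := by
  have hpi := Real.pi_pos
  set L := Complex.log a with hLdef
  have hL : 0 ≤ L.im := by rw [hLdef, Complex.log_im]; exact Complex.arg_nonneg_iff.2 ha2
  have hk : L ≠ 0 ∨ -1 < k.re := by
    by_cases h1 : a = 1
    · exact Or.inr (ha1 h1)
    · refine Or.inl fun h0 => h1 ?_
      rw [← Complex.exp_log ha, ← hLdef, h0, Complex.exp_zero]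
  set f : ℂ → ℂ := fun y => (y - Complex.I * L) ^ k * Complex.exp (Complex.I * m * y) with hf
  have hfint : IntegrableOn (fun y : ℝ => f y) (Set.Ioi 0) := integrableOn_cpow_mul_exp hm hL hk
  have hfd : ∀ y : ℂ, 0 < y.re → DifferentiableAt ℂ f y := by
    intro y hy
    refine DifferentiableAt.mul (DifferentiableAt.cpow_const (by fun_prop) ?_) (by fun_prop)
    rw [Complex.mem_slitPlane_iff]
    left
    simp
    linarith
  -- A bounded open neighbourhood of `[0, 2π]`; the radius need only exceed `2π`.
  set U : Set ℂ := {y | -Real.pi < y.re} ∩ Metric.ball 0 10 with hU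
  have hUo : IsOpen U := (isOpen_lt continuous_const Complex.continuous_re).inter Metric.isOpen_ball
  have hUmem : ∀ y ∈ Set.Icc 0 (2 * Real.pi), (y : ℂ) ∈ U := by
    intro y hy
    refine ⟨by simp; linarith [hy.1], ?_⟩
    rw [mem_ball_zero_iff, Complex.norm_real, Real.norm_of_nonneg hy.1]
    linarith [hy.2, Real.pi_lt_d2]
  obtain ⟨C, hC⟩ := exists_norm_cpow_mul_exp_translate_le (k := k) hm hL 10
  have hu : Summable (fun p : ℕ => C * Real.exp (-(Real.pi * m.im)) ^ p) := by
    refine (summable_geometric_of_lt_one (Real.exp_pos _).le ?_).mul_left C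
    rw [Real.exp_lt_one_iff]
    have := mul_pos hpi hm
    linarith
  have hbound : ∀ (p : ℕ) (y : ℂ), y ∈ U → ‖f (y + 2 * Real.pi * (p + 1))‖ ≤
      C * Real.exp (-(Real.pi * m.im)) ^ p := fun p y hy =>
    hC p y hy.1 (mem_ball_zero_iff.1 hy.2)
  set tail : ℂ → ℂ := fun y => ∑' p : ℕ, f (y + 2 * Real.pi * (p + 1)) with htail
  have htd : DifferentiableOn ℂ tail U := by
    refine Complex.differentiableOn_tsum_of_summable_norm hu (fun p y hy => ?_) hUo hbound
    refine DifferentiableAt.differentiableWithinAt ?_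
    refine DifferentiableAt.comp (f := fun y : ℂ => y + 2 * Real.pi * (p + 1)) (g := f) y (hfd _ ?_)
      (by fun_prop)
    have : (2 * Real.pi * (p + 1) : ℂ) = ((2 * Real.pi * (p + 1) : ℝ) : ℂ) := by push_cast; ring
    rw [this, Complex.add_re, Complex.ofReal_re]
    have := hy.1
    simp only [Set.mem_ofPred_eq] at this
    have : 0 ≤ Real.pi * p := by positivity
    linarith
  -- The term `p = 0` is kept apart: it may be singular at `y = 0` and is merely integrable there,
  -- while the tail is holomorphic around all of `[0, 2π]`.
  set G : ℝ → ℂ := fun y => f y + tail y with hG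
  have hGsum : ∀ y ∈ Set.Ioc 0 (2 * Real.pi),
      HasSum (fun p : ℕ => f ((y + 2 * Real.pi * p : ℝ) : ℂ)) (G y) := by
    intro y hy
    have h1 : HasSum (fun p : ℕ => f ((y : ℂ) + 2 * Real.pi * (p + 1))) (tail y) :=
      (hu.of_norm_bounded fun p => hbound p y (hUmem y ⟨hy.1.le, hy.2⟩)).hasSum
    have h2 := (hasSum_nat_add_iff (f := fun p : ℕ => f ((y + 2 * Real.pi * p : ℝ) : ℂ)) 1
      (g := tail y)).1 (by
        refine h1.congr_fun fun p => ?_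
        push_cast; rfl)
    simpa [hG, add_comm] using h2
  have hGint : IntegrableOn G (Set.Ioc 0 (2 * Real.pi)) := by
    refine (hfint.mono_set Set.Ioc_subset_Ioi_self).add ?_
    have h1 : ContinuousOn (fun y : ℝ => tail y) (Set.Icc 0 (2 * Real.pi)) :=
      htd.continuousOn.comp Complex.continuous_ofReal.continuousOn hUmem
    exact (h1.integrableOn_Icc).mono_set Set.Ioc_subset_Icc_self
  have hGd : DifferentiableAt ℝ G β := by
    have h1 : DifferentiableAt ℂ (fun y => f y + tail y) (β : ℂ) :=
      (hfd β (by simpa using hβ0)).add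
        (htd.differentiableAt (hUo.mem_nhds (hUmem β ⟨hβ0.le, hβ1.le⟩)))
    exact h1.hasDerivAt.comp_ofReal.differentiableAt
  have h := (tendsto_sum_integral_mul_exp hβ0 hβ1 hGint hGd).const_mul
    (Complex.I * Complex.exp (Complex.I * (k * Real.pi) / 2))
  convert h using 1
  · ext N
    rw [Finset.mul_sum]
    refine Finset.sum_congr rfl fun n _ => ?_
    rw [← integral_Ioi_eq_integral_periodization (f := fun y : ℝ => f y) hfint hGsum,
      bilateralTerm_eq_rayIntegral ha ha1 hm ha2, rayIntegral, ← integral_const_mul,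
      ← integral_const_mul, ← integral_const_mul]
    refine setIntegral_congr_fun measurableSet_Ioi fun y hy => ?_
    simp only [hf, ← hLdef]
    have h1 : L + y * Complex.I = Complex.I * (y - Complex.I * L) := by
      linear_combination L * Complex.I_sq
    have h2 : (L + y * Complex.I) ^ k =
        Complex.exp (Complex.I * (k * Real.pi) / 2) * (y - Complex.I * L) ^ k := by
      rw [h1]
      refine I_mul_cpow_of_re_pos ?_ k
      have : (0 : ℝ) < y := hy
      simp
      linarith
    rw [h2]
    have h3 : Complex.exp (Complex.I * n * β) * Complex.exp ((n - m) * L) *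
        Complex.exp (-((n - m) * (L + y * Complex.I))) =
        Complex.exp (Complex.I * m * y) * Complex.exp (Complex.I * n * (β - y)) := by
      rw [← Complex.exp_add, ← Complex.exp_add, ← Complex.exp_add]
      congr 1; ring
    linear_combination (Complex.exp (Complex.I * (k * Real.pi) / 2) * (y - Complex.I * L) ^ k *
      Complex.I) * h3
  · congr 1
    have hz : ‖Complex.exp (2 * Complex.I * m * Real.pi)‖ < 1 := by
      rw [Complex.norm_exp, Real.exp_lt_one_iff]
      have : (2 * Complex.I * m * Real.pi).re = -(2 * (m.im * Real.pi)) := by simp; ring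
      rw [this]
      have := mul_pos hm hpi
      linarith
    rw [lerchPhi_of_norm_lt_one hz, ← (hGsum β ⟨hβ0, hβ1.le⟩).tsum_eq, lerchSeries]
    have h2pi : (2 * Real.pi : ℂ) ≠ 0 := by
      have : (Real.pi : ℂ) ≠ 0 := by exact_mod_cast hpi.ne'
      simp [this]
    have h1 : ∀ p : ℕ, f ((β + 2 * Real.pi * p : ℝ) : ℂ) = (2 * Real.pi : ℂ) ^ k *
        Complex.exp (Complex.I * m * β) * (Complex.exp (2 * Complex.I * m * Real.pi) ^ p /
          (p + (β - Complex.I * L) / (2 * Real.pi)) ^ (-k)) := by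
      intro p
      simp only [hf]
      have h3 : ((β + 2 * Real.pi * p : ℝ) : ℂ) - Complex.I * L =
          ((2 * Real.pi : ℝ) : ℂ) * (p + (β - Complex.I * L) / (2 * Real.pi)) := by
        push_cast; field_simp; ring
      have h4 : (p + (β - Complex.I * L) / (2 * Real.pi) : ℂ) ≠ 0 := by
        intro h0
        rw [h0, mul_zero] at h3
        have h5 := congrArg Complex.re h3
        simp at h5
        have : 0 ≤ 2 * Real.pi * (p : ℝ) := by positivity
        linarith
      rw [h3, mul_cpow_of_arg_add (by exact_mod_cast (by positivity : (2 * Real.pi) ≠ 0)) h4 (by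
        rw [Complex.arg_ofReal_of_nonneg (by positivity), zero_add]
        exact Complex.arg_mem_Ioc _), Complex.cpow_neg, div_inv_eq_mul, ← Complex.exp_nat_mul]
      have h6 : Complex.exp (Complex.I * m * ((β + 2 * Real.pi * p : ℝ) : ℂ)) =
          Complex.exp (Complex.I * m * β) * Complex.exp (p * (2 * Complex.I * m * Real.pi)) := by
        rw [← Complex.exp_add]; push_cast; ring_nf
      rw [h6]
      push_cast
      ring
    simp_rw [h1]
    rw [tsum_mul_left, Complex.cpow_add _ _ h2pi, Complex.cpow_one]
    have h2 : Complex.exp (Complex.I * (k * Real.pi + 2 * m * β) / 2) =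
        Complex.exp (Complex.I * (k * Real.pi) / 2) * Complex.exp (Complex.I * m * β) := by
      rw [← Complex.exp_add]; congr 1; ring
    rw [h2]
    ring

/-! ### Continuation of `Φ(z, r, α)`, `r ≥ 1`, to the slit plane. -/

theorem one_notMem_lerchSlitPlane : (1 : ℂ) ∉ lerchSlitPlane := by
  simp [lerchSlitPlane]

theorem isOpen_lerchSlitPlane : IsOpen lerchSlitPlane := by
  have h : lerchSlitPlane = {z : ℂ | z.im = 0 ∧ 1 ≤ z.re}ᶜ := rfl
  rw [h, isOpen_compl_iff]
  exact (isClosed_eq Complex.continuous_im continuous_const).inter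
    (isClosed_le continuous_const Complex.continuous_re)

theorem zero_mem_lerchSlitPlane : (0 : ℂ) ∈ lerchSlitPlane := by
  simp [lerchSlitPlane]

theorem isPreconnected_lerchSlitPlane : IsPreconnected lerchSlitPlane := by
  have h : StarConvex ℝ 0 lerchSlitPlane := by
    rintro z hz u v hu hv huv ⟨h1, h2⟩
    simp at h1 h2
    apply hz
    have hv0 : 0 < v := lt_of_le_of_ne hv (by rintro rfl; norm_num at h2)
    refine ⟨h1.resolve_left hv0.ne', ?_⟩
    have : v * z.re ≤ 1 * z.re := by
      gcongr
      · by_contra h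
        nlinarith
      · linarith
    linarith
  exact (h.isPathConnected zero_mem_lerchSlitPlane).isConnected.isPreconnected

/-- Even if `lerchPhi` picks a continuation to the complement of `1`, its restriction to the slit
plane agrees with `F` by uniqueness. -/
theorem lerchPhi_eq_of_isLerchContinuation_lerchSlitPlane {s a : ℂ} {F : ℂ → ℂ}
    (hF : IsLerchContinuation lerchSlitPlane s a F) {z : ℂ} (hz : z ∈ lerchSlitPlane) :
    lerchPhi z s a = F z := by
  have hz1 : z ≠ 1 := by rintro rfl; exact one_notMem_lerchSlitPlane hz
  by_cases h1 : ‖z‖ < 1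
  · rw [lerchPhi_of_norm_lt_one h1, hF.2 z h1]
  by_cases h2 : ∃ F, IsLerchContinuation {1}ᶜ s a F
  · obtain ⟨F', hF'⟩ := h2
    rw [lerchPhi_eq_of_isLerchContinuation_compl hF' hz1]
    refine IsLerchContinuation.eqOn isPreconnected_lerchSlitPlane zero_mem_lerchSlitPlane
      ⟨hF'.1.mono ?_, hF'.2⟩ hF hz
    rintro y hy rfl
    exact one_notMem_lerchSlitPlane hy
  · have h : ∃ F, IsLerchContinuation lerchSlitPlane s a F := ⟨F, hF⟩
    rw [lerchPhi, if_neg (by tauto), dif_neg h2, dif_pos h]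
    exact h.choose_spec.eqOn isPreconnected_lerchSlitPlane zero_mem_lerchSlitPlane hF hz

theorem exists_pos_le_norm_one_sub_mul {z₀ : ℂ} (hz : z₀ ∈ lerchSlitPlane) :
    ∃ c : ℝ, 0 < c ∧ ∀ z ∈ Metric.ball z₀ c, ∀ x ∈ Set.Icc (0 : ℝ) 1, c ≤ ‖1 - z * x‖ := by
  obtain ⟨p, hp, hmin⟩ := (isCompact_Icc (a := (0 : ℝ)) (b := 1)).exists_isMinOn
    ⟨0, by simp⟩ (f := fun x : ℝ => ‖1 - z₀ * x‖) (by fun_prop)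
  have hpos : 0 < ‖1 - z₀ * p‖ := by
    rw [norm_pos_iff]
    intro h0
    have h1 : z₀ * p = 1 := (sub_eq_zero.1 h0).symm
    have h2 := congrArg Complex.re h1
    have h3 := congrArg Complex.im h1
    simp at h2 h3
    have hp0 : p ≠ 0 := by rintro rfl; simp at h2
    apply hz
    refine ⟨by tauto, ?_⟩
    have : z₀.re = 1 / p := by field_simp; linarith
    rw [this, le_div_iff₀ (lt_of_le_of_ne hp.1 hp0.symm)]
    linarith [hp.2]
  refine ⟨‖1 - z₀ * p‖ / 2, by positivity, fun z hz x hx => ?_⟩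
  have h1 := hmin hx
  simp only [Set.mem_ofPred_eq] at h1
  have h2 : ‖1 - z₀ * x‖ ≤ ‖1 - z * x‖ + ‖z - z₀‖ := by
    have h3 : 1 - z₀ * x = (1 - z * x) + (z - z₀) * x := by ring
    rw [h3]
    refine (norm_add_le _ _).trans ?_
    gcongr
    rw [norm_mul, Complex.norm_real, Real.norm_of_nonneg hx.1]
    exact mul_le_of_le_one_right (norm_nonneg _) hx.2
  rw [mem_ball_iff_norm] at hz
  linarith

theorem differentiableOn_integral_div_one_sub_mul_exp {φ : ℝ → ℂ}
    (hφ : IntegrableOn φ (Set.Ioi 0)) :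
    DifferentiableOn ℂ (fun z : ℂ => ∫ t in Set.Ioi (0 : ℝ), φ t / (1 - z * Real.exp (-t)))
      lerchSlitPlane := by
  intro z₀ hz₀
  obtain ⟨c, hc0, hc⟩ := exists_pos_le_norm_one_sub_mul hz₀
  have hexp : ∀ t ∈ Set.Ioi (0 : ℝ), Real.exp (-t) ∈ Set.Icc (0 : ℝ) 1 := fun t ht =>
    ⟨(Real.exp_pos _).le, Real.exp_le_one_iff.2 (by simpa using le_of_lt ht)⟩
  have hmeas : ∀ z : ℂ, AEStronglyMeasurable (fun t : ℝ => φ t / (1 - z * Real.exp (-t)))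
      (volume.restrict (Set.Ioi 0)) := fun z =>
    hφ.aestronglyMeasurable.div₀ (Continuous.aestronglyMeasurable (by fun_prop))
  have hb : ∀ t ∈ Set.Ioi (0 : ℝ), ∀ z ∈ Metric.ball z₀ c, c ≤ ‖1 - z * Real.exp (-t)‖ :=
    fun t ht z hz => hc z hz _ (hexp t ht)
  have h := hasDerivAt_integral_of_dominated_loc_of_deriv_le (μ := volume.restrict (Set.Ioi (0 : ℝ)))
    (F := fun z t => φ t / (1 - z * Real.exp (-t)))
    (F' := fun z t => φ t * Real.exp (-t) / (1 - z * Real.exp (-t)) ^ 2)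
    (bound := fun t => ‖φ t‖ / c ^ 2) (x₀ := z₀) (Metric.ball_mem_nhds z₀ hc0)
    (Eventually.of_forall hmeas) ?_ ?_ ?_ (hφ.norm.div_const _) ?_
  · exact h.2.differentiableAt.differentiableWithinAt
  · refine (hφ.norm.div_const c).mono' (hmeas z₀) ?_
    refine (ae_restrict_iff' measurableSet_Ioi).2 (Eventually.of_forall fun t ht => ?_)
    rw [norm_div]
    gcongr
    exact hb t ht z₀ (Metric.mem_ball_self hc0)
  · exact (hφ.aestronglyMeasurable.mul (Continuous.aestronglyMeasurable (by fun_prop))).div₀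
      (Continuous.aestronglyMeasurable (by fun_prop))
  · refine (ae_restrict_iff' measurableSet_Ioi).2 (Eventually.of_forall fun t ht z hz => ?_)
    rw [norm_div, norm_mul, norm_pow, Complex.norm_real, Real.norm_of_nonneg (hexp t ht).1]
    have := hb t ht z hz
    gcongr
    exact mul_le_of_le_one_right (norm_nonneg _) (hexp t ht).2
  · refine (ae_restrict_iff' measurableSet_Ioi).2 (Eventually.of_forall fun t ht z hz => ?_)
    have hne : 1 - z * (Real.exp (-t) : ℂ) ≠ 0 :=
      norm_pos_iff.1 (hc0.trans_le (hb t ht z hz))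
    have h1 : HasDerivAt (fun z : ℂ => 1 - z * (Real.exp (-t) : ℂ)) (-(1 * (Real.exp (-t) : ℂ))) z :=
      ((hasDerivAt_id z).mul_const _).const_sub 1
    refine ((hasDerivAt_const z (φ t)).fun_div h1 hne).congr_deriv ?_
    ring

theorem upperIncompleteGamma_natCast_zero (q : ℕ) :
    upperIncompleteGamma (1 + q) 0 = (q.factorial : ℂ) := by
  induction q with
  | zero => rw [upperIncompleteGamma_one]; simp
  | succ q ih =>
    rw [upperIncompleteGamma_succ, ih, Nat.factorial_succ]
    simp

/-- Rotate the ray for `Γ(1 + q, 0) = q!` to the direction `c` and rescale. -/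
theorem rayIntegral_natCast_zero_one {c : ℂ} (hc : 0 < c.re) (q : ℕ) :
    rayIntegral q c 0 1 = (q.factorial : ℂ) / c ^ (q + 1) := by
  have hc0 : c ≠ 0 := by rintro rfl; simp at hc
  have h1 := rayIntegral_scale (κ := q) (z := 0) (d := 1) hc0 (fun x _ => by
    simp only [Complex.cpow_natCast, mul_pow])
  have h2 := upperIncompleteGamma_natCast_zero q
  rw [upperIncompleteGamma_eq_rayIntegral, add_sub_cancel_left,
    rayIntegral_rotate (d₂ := c) (by simp [rayDir_re]) (by simpa using hc) (fun a b ha hb hab =>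
      add_rayDir_mem_slitPlane hc (Or.inr rfl) (fun b hb => ?_) ha hb hab)
      (Or.inr (by simp; linarith [Nat.cast_nonneg (α := ℝ) q]))] at h2
  · rw [mul_zero, mul_one, h2] at h1
    have h3 : c ^ ((q : ℂ) + 1) = c ^ (q + 1) := by
      rw [← Complex.cpow_natCast]; push_cast; rfl
    rw [h1, h3, mul_div_cancel_left₀ _ (pow_ne_zero _ hc0)]
  · rw [Complex.mem_slitPlane_iff]
    left
    simp
    positivity

theorem integral_pow_mul_exp_neg_mul {c : ℂ} (hc : 0 < c.re) (q : ℕ) :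
    ∫ t in Set.Ioi (0 : ℝ), (t : ℂ) ^ q * Complex.exp (-(c * t)) = (q.factorial : ℂ) / c ^ (q + 1) := by
  rw [← rayIntegral_natCast_zero_one hc, rayIntegral]
  simp

theorem integrableOn_pow_mul_exp_neg_mul {c : ℂ} (hc : 0 < c.re) (q : ℕ) :
    IntegrableOn (fun t : ℝ => (t : ℂ) ^ q * Complex.exp (-(c * t))) (Set.Ioi 0) := by
  have h := integrableOn_cpow_mul_exp_ray (κ := q) (w := c) (z := 0) (d := 1) (by simpa using hc)
    (fun x hx => by rw [Complex.mem_slitPlane_iff]; left; simpa using hx)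
    (Or.inr (by simp; linarith [Nat.cast_nonneg (α := ℝ) q]))
  simpa using h

/-- For `‖z‖ < 1`, expand `1 / (1 - z e^{-t})` geometrically and integrate termwise. The integral
stays holomorphic as long as `1 - z x` has no zero for `x ∈ [0, 1]`. -/
theorem isLerchContinuation_integral {α : ℂ} (hα : 0 < α.re) (q : ℕ) :
    IsLerchContinuation lerchSlitPlane ((q + 1 : ℕ) : ℂ) α (fun z => (q.factorial : ℂ)⁻¹ *
      ∫ t in Set.Ioi (0 : ℝ), ((t : ℂ) ^ q * Complex.exp (-(α * t))) /
        (1 - z * Real.exp (-t))) := by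
  have hφ := integrableOn_pow_mul_exp_neg_mul hα q
  refine ⟨DifferentiableOn.analyticOnNhd
    ((differentiableOn_integral_div_one_sub_mul_exp hφ).const_mul _) isOpen_lerchSlitPlane,
    fun z hz => ?_⟩
  have hre : ∀ n : ℕ, 0 < ((n : ℂ) + α).re := fun n => by simp; positivity
  have hint : ∀ n : ℕ, IntegrableOn (fun t : ℝ => z ^ n *
      ((t : ℂ) ^ q * Complex.exp (-((n + α) * t)))) (Set.Ioi 0) := fun n =>
    (integrableOn_pow_mul_exp_neg_mul (hre n) q).const_mul _
  have h := hasSum_integral_of_summable_integral_norm hint ?_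
  · simp_rw [integral_const_mul, integral_pow_mul_exp_neg_mul (hre _)] at h
    have h2 := h.mul_left (q.factorial : ℂ)⁻¹
    have hq : (q.factorial : ℂ) ≠ 0 := by exact_mod_cast q.factorial_ne_zero
    rw [lerchSeries]
    have h3 : ∀ n : ℕ, z ^ n / ((n : ℂ) + α) ^ ((q + 1 : ℕ) : ℂ) =
        (q.factorial : ℂ)⁻¹ * (z ^ n * ((q.factorial : ℂ) / ((n : ℂ) + α) ^ (q + 1))) := by
      intro n
      rw [Complex.cpow_natCast]
      field_simp
    simp_rw [h3]
    rw [h2.tsum_eq]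
    congr 1
    refine setIntegral_congr_fun measurableSet_Ioi fun t ht => ?_
    have hlt : ‖z * (Real.exp (-t) : ℂ)‖ < 1 := by
      rw [norm_mul, Complex.norm_real, Real.norm_of_nonneg (Real.exp_pos _).le]
      have : Real.exp (-t) ≤ 1 := Real.exp_le_one_iff.2 (by simpa using le_of_lt ht)
      calc ‖z‖ * Real.exp (-t) ≤ ‖z‖ * 1 := by gcongr
        _ < 1 := by linarith
    have h4 := (hasSum_geometric_of_norm_lt_one hlt).mul_left
      ((t : ℂ) ^ q * Complex.exp (-(α * t)))
    rw [div_eq_mul_inv, ← h4.tsum_eq]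
    congr 1
    ext n
    have h5 : Complex.exp (-((n + α) * t)) = Complex.exp (-(α * t)) * (Real.exp (-t) : ℂ) ^ n := by
      push_cast
      rw [← Complex.exp_nat_mul, ← Complex.exp_add]
      congr 1; ring
    rw [h5, mul_pow]
    ring
  · refine Summable.of_nonneg_of_le (fun n => by positivity) (fun n => ?_)
      ((summable_geometric_of_lt_one (norm_nonneg z) hz).mul_right
        (∫ t in Set.Ioi (0 : ℝ), ‖(t : ℂ) ^ q * Complex.exp (-(α * t))‖))
    rw [← integral_const_mul]
    refine setIntegral_mono_on (hint n).norm (hφ.norm.const_mul _) measurableSet_Ioi fun t ht => ?_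
    rw [norm_mul, norm_pow, norm_mul, norm_mul, Complex.norm_exp, Complex.norm_exp]
    have h6 : Real.exp (-((n + α) * t)).re ≤ Real.exp (-(α * t)).re := by
      refine Real.exp_le_exp.2 ?_
      have : (0 : ℝ) < t := ht
      have h7 : (-((n + α) * t)).re = (-(α * t)).re - n * t := by simp; ring
      rw [h7]
      have : 0 ≤ n * t := by positivity
      linarith
    gcongr

theorem exists_isLerchContinuation_lerchSlitPlane {α : ℂ} (hα : 0 < α.re) {r : ℕ} (hr : r ≠ 0) :
    ∃ F, IsLerchContinuation lerchSlitPlane (r : ℂ) α F := by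
  obtain ⟨q, rfl⟩ := Nat.exists_eq_succ_of_ne_zero hr
  exact ⟨_, isLerchContinuation_integral hα q⟩

/-! ### Geometric series under the integral sign. -/

/-- Compactness on `[0, 1 / e.re]`, where `q ≠ 1` excludes a zero at `x = 0`; beyond it the
exponential has norm at most `1/2`. -/
theorem exists_pos_le_norm_one_sub_mul_exp {e q : ℂ} (he : 0 < e.re) (hq : ‖q‖ = 1) (hq1 : q ≠ 1) :
    ∃ c : ℝ, 0 < c ∧ ∀ x : ℝ, 0 < x → c ≤ ‖1 - q * Complex.exp (-(x * e))‖ := by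
  have hnorm : ∀ x : ℝ, ‖q * Complex.exp (-(x * e))‖ = Real.exp (-(x * e.re)) := fun x => by
    rw [norm_mul, hq, one_mul, Complex.norm_exp, Complex.neg_re, Complex.re_ofReal_mul]
  obtain ⟨p, hp, hmin⟩ := (isCompact_Icc (a := (0 : ℝ)) (b := 1 / e.re)).exists_isMinOn
    ⟨0, by simp [he.le]⟩ (f := fun x : ℝ => ‖1 - q * Complex.exp (-(x * e))‖) (by fun_prop)
  have hpos : 0 < ‖1 - q * Complex.exp (-(p * e))‖ := by
    rw [norm_pos_iff]
    intro h0
    have h1 : q * Complex.exp (-(p * e)) = 1 := (sub_eq_zero.1 h0).symm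
    rcases hp.1.eq_or_lt with h2 | h2
    · rw [← h2] at h1
      apply hq1
      simpa using h1
    · have h3 := hnorm p
      rw [h1, norm_one] at h3
      have h4 : Real.exp (-(p * e.re)) < 1 := by
        rw [Real.exp_lt_one_iff]
        have := mul_pos h2 he
        linarith
      linarith
  refine ⟨min ‖1 - q * Complex.exp (-(p * e))‖ (1 / 2), by positivity, fun x hx => ?_⟩
  rcases le_or_gt x (1 / e.re) with h | h
  · exact (min_le_left _ _).trans (hmin ⟨hx.le, h⟩)
  · refine (min_le_right _ _).trans ?_
    have h1 : Real.exp (-(x * e.re)) ≤ 1 / 2 := by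
      rw [div_lt_iff₀ he] at h
      calc Real.exp (-(x * e.re)) ≤ Real.exp (-1) := Real.exp_le_exp.2 (by linarith)
        _ ≤ 1 / 2 := by
          have := Real.exp_neg_one_lt_d9
          linarith
    have h2 := norm_sub_norm_le 1 (q * Complex.exp (-(x * e)))
    rw [hnorm, norm_one] at h2
    linarith

theorem norm_exp_neg_mul_ofReal_mul (w d : ℂ) (x : ℝ) :
    ‖Complex.exp (-(w * (x * d)))‖ = Real.exp (-(w * d).re * x) := by
  rw [Complex.norm_exp]
  congr 1
  rw [show -(w * (x * d)) = (x : ℂ) * -(w * d) by ring, Complex.re_ofReal_mul, Complex.neg_re]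
  ring

theorem integrableOn_mul_exp_of_bounded {ψ : ℝ → ℂ} {C : ℝ} {w d : ℂ}
    (hψ : AEStronglyMeasurable ψ (volume.restrict (Set.Ioi 0)))
    (hC : ∀ x : ℝ, 0 < x → ‖ψ x‖ ≤ C) (hw : 0 < (w * d).re) :
    IntegrableOn (fun x : ℝ => ψ x * Complex.exp (-(w * (x * d)))) (Set.Ioi 0) := by
  refine (integrableOn_rpow_mul_exp (σ := 0) (by norm_num) hw C).mono'
    (hψ.mul (Continuous.aestronglyMeasurable (by fun_prop))) ?_
  refine (ae_restrict_iff' measurableSet_Ioi).2 (Eventually.of_forall fun x hx => ?_)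
  rw [norm_mul, norm_exp_neg_mul_ofReal_mul, Real.rpow_zero, one_mul]
  gcongr
  exact hC x hx

theorem differentiableAt_integral_mul_exp_of_bounded {ψ : ℝ → ℂ} {C : ℝ} {c d m : ℂ}
    (hψ : AEStronglyMeasurable ψ (volume.restrict (Set.Ioi 0)))
    (hC : ∀ x : ℝ, 0 < x → ‖ψ x‖ ≤ C) (hm : 0 < ((c - m) * d).re) :
    DifferentiableAt ℂ (fun m : ℂ => ∫ x in Set.Ioi (0 : ℝ),
      ψ x * Complex.exp (-((c - m) * (x * d)))) m := by
  set δ := ((c - m) * d).re with hδ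
  have hC0 : 0 ≤ C := (norm_nonneg _).trans (hC 1 one_pos)
  have hs : {m' : ℂ | δ / 2 < ((c - m') * d).re} ∈ 𝓝 m := by
    refine IsOpen.mem_nhds (isOpen_lt continuous_const (by fun_prop)) ?_
    simp only [Set.mem_ofPred_eq, ← hδ]
    linarith
  have h := hasDerivAt_integral_of_dominated_loc_of_deriv_le
    (μ := volume.restrict (Set.Ioi (0 : ℝ)))
    (F := fun m x => ψ x * Complex.exp (-((c - m) * (x * d))))
    (F' := fun m x => ψ x * (Complex.exp (-((c - m) * (x * d))) * (x * d)))
    (bound := fun x => C * ‖d‖ * (x ^ (1 : ℝ) * Real.exp (-(δ / 2) * x))) (x₀ := m) hs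
    (Eventually.of_forall fun m => hψ.mul (Continuous.aestronglyMeasurable (by fun_prop)))
    (integrableOn_mul_exp_of_bounded hψ hC hm)
    (hψ.mul (Continuous.aestronglyMeasurable (by fun_prop))) ?_
    (integrableOn_rpow_mul_exp (by norm_num) (by linarith) _) ?_
  · exact h.2.differentiableAt
  · refine (ae_restrict_iff' measurableSet_Ioi).2 (Eventually.of_forall fun x hx m' hm' => ?_)
    have hx0 : (0 : ℝ) < x := hx
    simp only [Set.mem_ofPred_eq] at hm'
    rw [norm_mul, norm_mul, norm_mul, norm_exp_neg_mul_ofReal_mul, Complex.norm_real,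
      Real.norm_of_nonneg hx0.le, Real.rpow_one]
    have h1 : Real.exp (-((c - m') * d).re * x) ≤ Real.exp (-(δ / 2) * x) := by
      refine Real.exp_le_exp.2 ?_
      gcongr
    calc ‖ψ x‖ * (Real.exp (-((c - m') * d).re * x) * (x * ‖d‖))
        ≤ C * (Real.exp (-(δ / 2) * x) * (x * ‖d‖)) := by gcongr; exact hC x hx0
      _ = _ := by ring
  · refine Eventually.of_forall fun x m' _ => ?_
    have h1 : HasDerivAt (fun m : ℂ => -((c - m) * (x * d))) (x * d) m' :=
      (((hasDerivAt_id m').const_sub c).mul_const ((x : ℂ) * d)).fun_neg.congr_deriv (by ring)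
    exact h1.cexp.const_mul (ψ x)

/-- The series of integrals need not converge absolutely. Hence dominated convergence is applied to
the partial sums, whose closed form is at most twice the limit integrand. -/
theorem tendsto_sum_integral_geometric {φ : ℝ → ℂ} {C : ℝ} {w d e q : ℂ}
    (hφ : AEStronglyMeasurable φ (volume.restrict (Set.Ioi 0)))
    (hC : ∀ x : ℝ, 0 < x → ‖φ x‖ ≤ C) (hw : 0 < (w * d).re) (he : 0 < e.re) (hq : ‖q‖ = 1)
    (hq1 : q ≠ 1) :
    Tendsto (fun N : ℕ => ∑ l ∈ Finset.range N, ∫ x in Set.Ioi (0 : ℝ),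
        φ x * Complex.exp (-(w * (x * d))) * (q * Complex.exp (-(x * e))) ^ l) atTop
      (𝓝 (∫ x in Set.Ioi (0 : ℝ), φ x / (1 - q * Complex.exp (-(x * e))) *
        Complex.exp (-(w * (x * d))))) := by
  obtain ⟨c, hc0, hc⟩ := exists_pos_le_norm_one_sub_mul_exp he hq hq1
  have hnorm : ∀ x : ℝ, ‖q * Complex.exp (-(x * e))‖ = Real.exp (-(x * e.re)) := fun x => by
    rw [norm_mul, hq, one_mul, Complex.norm_exp, Complex.neg_re, Complex.re_ofReal_mul]
  have hlt : ∀ x : ℝ, 0 < x → ‖q * Complex.exp (-(x * e))‖ < 1 := fun x hx => by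
    rw [hnorm, Real.exp_lt_one_iff]
    have := mul_pos hx he
    linarith
  have hψ : AEStronglyMeasurable (fun x : ℝ => φ x / (1 - q * Complex.exp (-(x * e))))
      (volume.restrict (Set.Ioi 0)) :=
    hφ.div₀ (Continuous.aestronglyMeasurable (by fun_prop))
  have hC0 : 0 ≤ C := (norm_nonneg _).trans (hC 1 one_pos)
  have hψC : ∀ x : ℝ, 0 < x → ‖φ x / (1 - q * Complex.exp (-(x * e)))‖ ≤ C / c := fun x hx => by
    rw [norm_div]
    gcongr
    · exact hC x hx
    · exact hc x hx
  have hψi := integrableOn_mul_exp_of_bounded hψ hψC hw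
  have hφi := integrableOn_mul_exp_of_bounded hφ hC hw
  have hsum : ∀ N : ℕ, ∑ l ∈ Finset.range N, ∫ x in Set.Ioi (0 : ℝ),
      φ x * Complex.exp (-(w * (x * d))) * (q * Complex.exp (-(x * e))) ^ l =
      ∫ x in Set.Ioi (0 : ℝ), φ x / (1 - q * Complex.exp (-(x * e))) *
        Complex.exp (-(w * (x * d))) * (1 - (q * Complex.exp (-(x * e))) ^ N) := by
    intro N
    rw [← integral_finsetSum]
    · refine setIntegral_congr_fun measurableSet_Ioi fun x hx => ?_
      have hne : 1 - q * Complex.exp (-(x * e)) ≠ 0 := norm_pos_iff.1 (hc0.trans_le (hc x hx))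
      rw [← Finset.mul_sum, ← mul_neg_geom_sum]
      field_simp
    · intro l _
      refine hφi.mul_bdd (c := 1) (Continuous.aestronglyMeasurable (by fun_prop)) ?_
      refine (ae_restrict_iff' measurableSet_Ioi).2 (Eventually.of_forall fun x hx => ?_)
      rw [norm_pow]
      exact pow_le_one₀ (norm_nonneg _) (hlt x hx).le
  simp_rw [hsum]
  refine tendsto_integral_of_dominated_convergence (fun x => ‖φ x / (1 - q * Complex.exp (-(x * e))) *
        Complex.exp (-(w * (x * d)))‖ * 2) (fun N => ?_) (hψi.norm.mul_const 2) (fun N => ?_) ?_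
  · exact hψi.aestronglyMeasurable.mul (Continuous.aestronglyMeasurable (by fun_prop))
  · refine (ae_restrict_iff' measurableSet_Ioi).2 (Eventually.of_forall fun x hx => ?_)
    rw [norm_mul]
    gcongr
    refine (norm_sub_le _ _).trans ?_
    rw [norm_one, norm_pow]
    have := pow_le_one₀ (n := N) (norm_nonneg _) (hlt x hx).le
    linarith
  · refine (ae_restrict_iff' measurableSet_Ioi).2 (Eventually.of_forall fun x hx => ?_)
    have h1 := (tendsto_pow_atTop_nhds_zero_of_norm_lt_one (hlt x hx)).const_sub 1
    have h2 := h1.const_mul (φ x / (1 - q * Complex.exp (-(x * e))) *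
        Complex.exp (-(w * (x * d))))
    simpa using h2

theorem tendsto_sum_Icc_of_tendsto_sum_range {f : ℤ → ℂ} (p : ℤ) {u v : ℂ}
    (hu : Tendsto (fun N : ℕ => ∑ l ∈ Finset.range N, f (p + l)) atTop (𝓝 u))
    (hv : Tendsto (fun N : ℕ => ∑ l ∈ Finset.range N, f (p - 1 - l)) atTop (𝓝 v)) :
    Tendsto (fun N : ℕ × ℕ => ∑ n ∈ Finset.Icc (-(N.1 : ℤ)) (N.2 : ℤ), f n) atTop (𝓝 (u + v)) := by
  have h1 : Tendsto (fun N : ℕ × ℕ => ((N.2 : ℤ) + 1 - p).toNat) atTop atTop := by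
    rw [← prod_atTop_atTop_eq]
    refine Tendsto.comp (g := fun N : ℕ => ((N : ℤ) + 1 - p).toNat) ?_ tendsto_snd
    exact tendsto_atTop.2 fun b => by
      filter_upwards [eventually_ge_atTop (b + p.natAbs)] with N hN
      omega
  have h2 : Tendsto (fun N : ℕ × ℕ => ((N.1 : ℤ) + p).toNat) atTop atTop := by
    rw [← prod_atTop_atTop_eq]
    refine Tendsto.comp (g := fun N : ℕ => ((N : ℤ) + p).toNat) ?_ tendsto_fst
    exact tendsto_atTop.2 fun b => by
      filter_upwards [eventually_ge_atTop (b + p.natAbs)] with N hN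
      omega
  refine ((hu.comp h1).add (hv.comp h2)).congr' ?_
  filter_upwards [eventually_ge_atTop (p.natAbs, p.natAbs)] with N hN
  obtain ⟨hN1, hN2⟩ := Prod.le_def.1 hN
  simp only [Function.comp] at *
  have hsplit : Finset.Icc (-(N.1 : ℤ)) (N.2 : ℤ) =
      Finset.Icc p (N.2 : ℤ) ∪ Finset.Icc (-(N.1 : ℤ)) (p - 1) := by
    ext n
    simp only [Finset.mem_union, Finset.mem_Icc]
    omega
  rw [hsplit, Finset.sum_union]
  · congr 1
    · refine Finset.sum_nbij (fun l => p + l) ?_ ?_ ?_ (fun _ _ => rfl)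
      · intro l hl
        simp only [Finset.mem_range, Finset.mem_Icc] at *
        omega
      · intro i _ j _ hij
        simpa using hij
      · intro n hn
        simp only [Finset.coe_Icc, Set.mem_Icc] at hn
        exact ⟨(n - p).toNat, by simp only [Finset.coe_range, Set.mem_Iio]; omega,
          by simp only; omega⟩
    · refine Finset.sum_nbij (fun l => p - 1 - l) ?_ ?_ ?_ (fun _ _ => rfl)
      · intro l hl
        simp only [Finset.mem_range, Finset.mem_Icc] at *
        omega
      · intro i _ j _ hij
        simpa using hij
      · intro n hn
        simp only [Finset.coe_Icc, Set.mem_Icc] at hn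
        exact ⟨(p - 1 - n).toNat, by simp only [Finset.coe_range, Set.mem_Iio]; omega,
          by simp only; omega⟩
  · rw [Finset.disjoint_left]
    intro n hn hn'
    simp only [Finset.mem_Icc] at *
    omega

/-! ### Tilted rays and continuation in `m` along a strip. -/

/-- A direction slightly above the positive real axis for `p ≤ n`, slightly above the negative
real axis for `n < p`. -/
noncomputable def tiltedDir (η : ℝ) (p n : ℤ) : ℂ :=
  if p ≤ n then 1 + η * Complex.I else -1 + η * Complex.I

theorem tiltedDir_im (η : ℝ) (p n : ℤ) : (tiltedDir η p n).im = η := by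
  rw [tiltedDir]; split_ifs <;> simp

/-- A part of the strip `p - 1 < Re m < p`. -/
def truncatedStrip (p : ℤ) (δ V : ℝ) : Set ℂ :=
  {m | (p - 1 + δ < m.re ∧ m.re < p - δ) ∧ -V < m.im}

theorem isOpen_truncatedStrip (p : ℤ) (δ V : ℝ) : IsOpen (truncatedStrip p δ V) :=
  ((isOpen_lt continuous_const Complex.continuous_re).inter
    (isOpen_lt Complex.continuous_re continuous_const)).inter
    (isOpen_lt continuous_const Complex.continuous_im)

theorem isPreconnected_truncatedStrip (p : ℤ) (δ V : ℝ) :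
    IsPreconnected (truncatedStrip p δ V) :=
  (((convex_halfSpace_re_gt _).inter (convex_halfSpace_re_lt _)).inter
    (convex_halfSpace_im_gt _)).isPreconnected

/-- The real part is `|n - m.re| + η * m.im`, which exceeds `δ - η * V`. -/
theorem mul_tiltedDir_re_pos {p : ℤ} {δ V η : ℝ} (hη : 0 < η) (hηV : η * V ≤ δ) {m : ℂ}
    (hm : m ∈ truncatedStrip p δ V) (n : ℤ) : 0 < (((n : ℂ) - m) * tiltedDir η p n).re := by
  obtain ⟨⟨h1, h2⟩, h3⟩ := hm
  have h4 : η * -V < η * m.im := by gcongr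
  rw [tiltedDir]
  split_ifs with hn
  · have hn' : (p : ℝ) ≤ n := by exact_mod_cast hn
    simp
    linarith
  · have hn' : (n : ℝ) ≤ p - 1 := by
      have : n ≤ p - 1 := by omega
      exact_mod_cast this
    simp
    linarith

theorem add_ofReal_mul_mem_slitPlane {L d : ℂ} (hL : 0 ≤ L.im) (hd : 0 < d.im) {x : ℝ}
    (hx : 0 < x) : L + x * d ∈ Complex.slitPlane := by
  rw [Complex.mem_slitPlane_iff]
  right
  rw [Complex.add_im, Complex.im_ofReal_mul]
  positivity

theorem aestronglyMeasurable_cpow_ray {κ L d A : ℂ} (hL : 0 ≤ L.im) (hd : 0 < d.im) :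
    AEStronglyMeasurable (fun x : ℝ => A * ((L + x * d) ^ κ * d))
      (volume.restrict (Set.Ioi 0)) := by
  refine ContinuousOn.aestronglyMeasurable (fun x hx => ?_) measurableSet_Ioi
  refine ContinuousAt.continuousWithinAt ?_
  refine continuousAt_const.mul (ContinuousAt.mul ?_ continuousAt_const)
  exact ContinuousAt.cpow (by fun_prop) continuousAt_const (add_ofReal_mul_mem_slitPlane hL hd hx)

theorem exists_norm_cpow_ray_le {L d A : ℂ} (hL : 0 ≤ L.im) (hL0 : L ≠ 0) (hd : 0 < d.im)
    (r : ℕ) : ∃ C : ℝ, ∀ x : ℝ, 0 < x → ‖A * ((L + x * d) ^ (-(r : ℂ)) * d)‖ ≤ C := by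
  have hd0 : d ≠ 0 := by rintro rfl; simp at hd
  have hre : 0 < ((starRingEnd ℂ) d * d).re := by
    rw [mul_comm, Complex.mul_conj, Complex.ofReal_re]
    exact Complex.normSq_pos.2 hd0
  obtain ⟨c, hc0, hc⟩ := exists_pos_le_norm_wedge (z := L) hre hre (fun a b ha hb h0 => by
    rcases (add_nonneg ha hb).eq_or_lt with h | h
    · have ha0 : a = 0 := by linarith
      have hb0 : b = 0 := by linarith
      apply hL0
      simpa [ha0, hb0] using h0
    · have := Complex.slitPlane_ne_zero (add_ofReal_mul_mem_slitPlane hL hd h)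
      apply this
      rw [← h0]
      push_cast
      ring)
  refine ⟨‖A‖ * ((c ^ r)⁻¹ * ‖d‖), fun x hx => ?_⟩
  have h1 := hc x 0 hx.le le_rfl
  rw [Complex.ofReal_zero, zero_mul, add_zero] at h1
  rw [norm_mul, norm_mul, Complex.cpow_neg, Complex.cpow_natCast, norm_inv, norm_pow]
  gcongr

/-- Moving `l` steps along the series multiplies the integrand by the `l`-th power of a fixed
factor. Upwards from `p` one takes `e = d`, downwards from `p - 1` one takes `e = -d`. -/
theorem exp_mul_rayIntegral_eq_integral_geometric {κ w w₀ L d e A q E : ℂ} (l : ℕ)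
    (hE : E = A * q ^ l) (hw : w * d = w₀ * d + l * e) :
    E * (Complex.exp (w * L) * rayIntegral κ w L d) = ∫ x in Set.Ioi (0 : ℝ),
      A * ((L + x * d) ^ κ * d) * Complex.exp (-(w₀ * (x * d))) *
        (q * Complex.exp (-(x * e))) ^ l := by
  rw [rayIntegral, ← integral_const_mul, ← integral_const_mul]
  refine setIntegral_congr_fun measurableSet_Ioi fun x _ => ?_
  have h : Complex.exp (w * L) * Complex.exp (-(w * (L + x * d))) =
      Complex.exp (-(w₀ * (x * d))) * Complex.exp (-(x * e)) ^ l := by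
    rw [← Complex.exp_nat_mul, ← Complex.exp_add, ← Complex.exp_add]
    congr 1
    linear_combination -(x : ℂ) * hw
  rw [hE, mul_pow]
  linear_combination A * q ^ l * (L + x * d) ^ κ * d * h

theorem exp_I_mul_ne_one {β : ℝ} (hβ0 : 0 < β) (hβ1 : β < 2 * Real.pi) :
    Complex.exp (Complex.I * β) ≠ 1 := by
  obtain ⟨c, hc0, hc⟩ := exists_pos_mul_abs_le_norm_one_sub_exp hβ0 hβ1
  intro h
  have h1 := hc 0 ⟨le_rfl, by positivity⟩
  simp only [Complex.ofReal_zero, sub_zero, h, sub_self, norm_zero, zero_sub, abs_neg,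
    abs_of_pos hβ0] at h1
  have := mul_pos hc0 hβ0
  linarith

/-- The sum of the series whose terms are given by integrals along tilted rays. -/
noncomputable def tiltedSum (κ L : ℂ) (β η : ℝ) (p : ℤ) (m : ℂ) : ℂ :=
  (∫ x in Set.Ioi (0 : ℝ), Complex.exp (Complex.I * p * β) *
      ((L + x * (1 + η * Complex.I)) ^ κ * (1 + η * Complex.I)) /
      (1 - Complex.exp (Complex.I * β) * Complex.exp (-(x * (1 + η * Complex.I)))) *
      Complex.exp (-((p - m) * (x * (1 + η * Complex.I))))) +
  ∫ x in Set.Ioi (0 : ℝ), Complex.exp (Complex.I * (p - 1) * β) *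
      ((L + x * (-1 + η * Complex.I)) ^ κ * (-1 + η * Complex.I)) /
      (1 - Complex.exp (-(Complex.I * β)) * Complex.exp (-(x * (1 - η * Complex.I)))) *
      Complex.exp (-((((p : ℂ) - 1) - m) * (x * (-1 + η * Complex.I))))

theorem norm_exp_I_mul (β : ℝ) : ‖Complex.exp (Complex.I * β)‖ = 1 := by
  rw [mul_comm, Complex.norm_exp_ofReal_mul_I]

theorem norm_exp_neg_I_mul (β : ℝ) : ‖Complex.exp (-(Complex.I * β))‖ = 1 := by
  rw [Complex.exp_neg, norm_inv, norm_exp_I_mul, inv_one]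

theorem exp_neg_I_mul_ne_one {β : ℝ} (hβ0 : 0 < β) (hβ1 : β < 2 * Real.pi) :
    Complex.exp (-(Complex.I * β)) ≠ 1 := by
  rw [Complex.exp_neg, Ne, inv_eq_one]
  exact exp_I_mul_ne_one hβ0 hβ1

theorem tendsto_sum_tilted {L : ℂ} {β η δ V : ℝ} {p : ℤ} (r : ℕ) (hL : 0 ≤ L.im) (hL0 : L ≠ 0)
    (hβ0 : 0 < β) (hβ1 : β < 2 * Real.pi) (hη : 0 < η) (hηV : η * V ≤ δ) {m : ℂ}
    (hm : m ∈ truncatedStrip p δ V) :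
    Tendsto (fun N : ℕ × ℕ => ∑ n ∈ Finset.Icc (-(N.1 : ℤ)) (N.2 : ℤ),
      Complex.exp (Complex.I * n * β) * (Complex.exp (((n : ℂ) - m) * L) *
        rayIntegral (-(r : ℂ)) ((n : ℂ) - m) L (tiltedDir η p n))) atTop
      (𝓝 (tiltedSum (-(r : ℂ)) L β η p m)) := by
  have h1 := mul_tiltedDir_re_pos hη hηV hm p
  have h2 := mul_tiltedDir_re_pos hη hηV hm (p - 1)
  rw [tiltedDir, if_pos le_rfl] at h1
  rw [tiltedDir, if_neg (by omega)] at h2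
  push_cast at h2
  refine tendsto_sum_Icc_of_tendsto_sum_range p ?_ ?_
  · obtain ⟨C, hC⟩ := exists_norm_cpow_ray_le (d := 1 + η * Complex.I)
      (A := Complex.exp (Complex.I * p * β)) hL hL0 (by simpa) r
    refine (tendsto_sum_integral_geometric (aestronglyMeasurable_cpow_ray hL (by simpa)) hC h1
      (e := 1 + η * Complex.I) (by simp) (norm_exp_I_mul β)
      (exp_I_mul_ne_one hβ0 hβ1)).congr fun N => ?_
    refine Finset.sum_congr rfl fun l _ => ?_
    rw [tiltedDir, if_pos (by omega)]
    refine (exp_mul_rayIntegral_eq_integral_geometric l ?_ ?_).symm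
    · rw [← Complex.exp_nat_mul, ← Complex.exp_add]
      push_cast
      congr 1; ring
    · push_cast; ring
  · obtain ⟨C, hC⟩ := exists_norm_cpow_ray_le (d := -1 + η * Complex.I)
      (A := Complex.exp (Complex.I * (p - 1) * β)) hL hL0 (by simpa) r
    refine (tendsto_sum_integral_geometric (aestronglyMeasurable_cpow_ray hL (by simpa)) hC h2
      (e := 1 - η * Complex.I) (by simp) (norm_exp_neg_I_mul β)
      (exp_neg_I_mul_ne_one hβ0 hβ1)).congr fun N => ?_
    refine Finset.sum_congr rfl fun l _ => ?_
    rw [tiltedDir, if_neg (by omega)]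
    refine (exp_mul_rayIntegral_eq_integral_geometric l ?_ ?_).symm
    · rw [← Complex.exp_nat_mul, ← Complex.exp_add]
      push_cast
      congr 1; ring
    · push_cast; ring

theorem differentiableOn_tiltedSum {L : ℂ} {β η δ V : ℝ} {p : ℤ} (r : ℕ) (hL : 0 ≤ L.im)
    (hL0 : L ≠ 0) (hβ0 : 0 < β) (hβ1 : β < 2 * Real.pi) (hη : 0 < η) (hηV : η * V ≤ δ) :
    DifferentiableOn ℂ (tiltedSum (-(r : ℂ)) L β η p) (truncatedStrip p δ V) := by
  intro m hm
  have h1 := mul_tiltedDir_re_pos hη hηV hm p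
  have h2 := mul_tiltedDir_re_pos hη hηV hm (p - 1)
  rw [tiltedDir, if_pos le_rfl] at h1
  rw [tiltedDir, if_neg (by omega)] at h2
  push_cast at h2
  refine DifferentiableAt.differentiableWithinAt ?_
  have main : ∀ (A d e q c : ℂ), 0 < d.im → 0 < e.re → ‖q‖ = 1 → q ≠ 1 → 0 < ((c - m) * d).re →
      DifferentiableAt ℂ (fun m : ℂ => ∫ x in Set.Ioi (0 : ℝ),
        A * ((L + x * d) ^ (-(r : ℂ)) * d) / (1 - q * Complex.exp (-(x * e))) *
        Complex.exp (-((c - m) * (x * d)))) m := by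
    intro A d e q c hd he hq hq1 hm
    obtain ⟨C, hC⟩ := exists_norm_cpow_ray_le (A := A) hL hL0 hd r
    obtain ⟨c', hc0, hc⟩ := exists_pos_le_norm_one_sub_mul_exp he hq hq1
    have hC0 : 0 ≤ C := (norm_nonneg _).trans (hC 1 one_pos)
    refine differentiableAt_integral_mul_exp_of_bounded (C := C / c')
      (ψ := fun x : ℝ => A * ((L + x * d) ^ (-(r : ℂ)) * d) / (1 - q * Complex.exp (-(x * e))))
      ((aestronglyMeasurable_cpow_ray hL hd).div₀
        (Continuous.aestronglyMeasurable (by fun_prop))) (fun x hx => ?_) hm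
    rw [norm_div]
    gcongr
    · exact hC x hx
    · exact hc x hx
  exact (main _ _ _ _ _ (by simpa) (by simp) (norm_exp_I_mul β)
    (exp_I_mul_ne_one hβ0 hβ1) h1).add (main _ _ _ _ _ (by simpa) (by simp)
    (norm_exp_neg_I_mul β) (exp_neg_I_mul_ne_one hβ0 hβ1) h2)

/-- A positive real value of `e^{2πim}` forces `m.re` to be an integer, so an open strip between
integers maps into the slit plane. -/
theorem exp_mem_lerchSlitPlane {m : ℂ} (hm : ∀ n : ℤ, m.re ≠ n) :
    Complex.exp (2 * Complex.I * m * Real.pi) ∈ lerchSlitPlane := by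
  rintro ⟨h1, h2⟩
  set z := Complex.exp (2 * Complex.I * m * Real.pi) with hz
  have h3 : z = Complex.exp (Real.log z.re : ℝ) := by
    rw [← Complex.ofReal_exp, Real.exp_log (by linarith)]
    exact Complex.ext (by simp) (by simpa using h1)
  rw [hz, Complex.exp_eq_exp_iff_exists_int] at h3
  obtain ⟨n, hn⟩ := h3
  have h4 := congrArg Complex.im hn
  simp at h4
  refine hm n ?_
  have hpi := Real.pi_pos
  have h5 : (2 * Real.pi) * (m.re - n) = 0 := by linarith
  rcases mul_eq_zero.1 h5 with h | h
  · linarith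
  · linarith

theorem tendsto_sum_tilted_lerchPhi {a : ℂ} {β η δ V : ℝ} {p : ℤ} {r : ℕ} (hr : r ≠ 0)
    (ha : a ≠ 0) (ha1 : a ≠ 1) (ha2 : 0 ≤ a.im)
    (hβ0 : 0 < β) (hβ1 : β < 2 * Real.pi) (hη : 0 < η) (hηV : η * V ≤ δ) (hδ : 0 < δ) {m : ℂ}
    (hm : m ∈ truncatedStrip p δ V) :
    Tendsto (fun N : ℕ × ℕ => ∑ n ∈ Finset.Icc (-(N.1 : ℤ)) (N.2 : ℤ),
      Complex.exp (Complex.I * n * β) * (Complex.exp (((n : ℂ) - m) * Complex.log a) *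
        rayIntegral (-(r : ℂ)) ((n : ℂ) - m) (Complex.log a) (tiltedDir η p n))) atTop
      (𝓝 (Complex.I * Complex.exp (Complex.I * (-(r : ℂ) * Real.pi + 2 * m * β) / 2) *
        (2 * Real.pi : ℂ) ^ (1 + -(r : ℂ)) *
        lerchPhi (Complex.exp (2 * Complex.I * m * Real.pi)) (- -(r : ℂ))
          ((β - Complex.I * Complex.log a) / (2 * Real.pi)))) := by
  set L := Complex.log a with hLdef
  have hL : 0 ≤ L.im := by rw [hLdef, Complex.log_im]; exact Complex.arg_nonneg_iff.2 ha2
  have hL0 : L ≠ 0 := fun h0 => ha1 (by rw [← Complex.exp_log ha, ← hLdef, h0, Complex.exp_zero])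
  have hα : 0 < ((β - Complex.I * L) / (2 * Real.pi)).re := by
    have : (2 * Real.pi : ℂ) = ((2 * Real.pi : ℝ) : ℂ) := by push_cast; ring
    rw [this, Complex.div_ofReal_re]
    refine div_pos ?_ (by positivity)
    simp
    linarith
  obtain ⟨F, hF⟩ := exists_isLerchContinuation_lerchSlitPlane hα hr
  set R : ℂ → ℂ := fun m => Complex.I * Complex.exp (Complex.I * (-(r : ℂ) * Real.pi + 2 * m * β) / 2) *
        (2 * Real.pi : ℂ) ^ (1 + -(r : ℂ)) * F (Complex.exp (2 * Complex.I * m * Real.pi)) with hR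
  have hslit : ∀ m ∈ truncatedStrip p δ V,
      Complex.exp (2 * Complex.I * m * Real.pi) ∈ lerchSlitPlane := by
    rintro m ⟨⟨h1, h2⟩, -⟩
    refine exp_mem_lerchSlitPlane fun n hn => ?_
    rw [hn] at h1 h2
    have h3 : (p : ℝ) - 1 < n := by linarith
    have h4 : (n : ℝ) < p := by linarith
    have h5 : p - 1 < n := by exact_mod_cast h3
    have h6 : n < p := by exact_mod_cast h4
    omega
  have hRd : DifferentiableOn ℂ R (truncatedStrip p δ V) := by
    intro m hm
    refine DifferentiableAt.differentiableWithinAt ?_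
    refine DifferentiableAt.mul (by fun_prop) ?_
    exact DifferentiableAt.comp (f := fun m => Complex.exp (2 * Complex.I * m * Real.pi)) m
      (hF.1 _ (hslit m hm)).differentiableAt (by fun_prop)
  have hS : Set.EqOn (tiltedSum (-(r : ℂ)) L β η p) R (truncatedStrip p δ V) := by
    -- A point of the strip straight above `m` with positive imaginary part; near it the Poisson
    -- case applies and starts the identity theorem.
    have hm1 : m + (|m.im| + 1 : ℝ) * Complex.I ∈ truncatedStrip p δ V := by
      obtain ⟨⟨h1, h2⟩, h3⟩ := hm
      refine ⟨⟨by simpa using h1, by simpa using h2⟩, ?_⟩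
      simp
      have := abs_nonneg m.im
      linarith
    refine AnalyticOnNhd.eqOn_of_preconnected_of_eventuallyEq
      ((differentiableOn_tiltedSum r hL hL0 hβ0 hβ1 hη hηV).analyticOnNhd
        (isOpen_truncatedStrip p δ V)) (hRd.analyticOnNhd (isOpen_truncatedStrip p δ V))
      (isPreconnected_truncatedStrip p δ V) hm1 ?_
    have hpos : ∀ᶠ m' : ℂ in 𝓝 (m + (|m.im| + 1 : ℝ) * Complex.I), 0 < m'.im := by
      refine (isOpen_lt continuous_const Complex.continuous_im).mem_nhds ?_
      simp
      have := neg_abs_le m.im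
      linarith
    filter_upwards [hpos, (isOpen_truncatedStrip p δ V).mem_nhds hm1] with m' hm'0 hm'
    have h1 := tendsto_sum_tilted r hL hL0 hβ0 hβ1 hη hηV hm'
    have h2 := tendsto_sum_bilateralTerm_of_im_pos (k := -(r : ℂ)) ha (fun h => absurd h ha1) hβ0
      hβ1 hm'0 ha2
    rw [neg_neg, lerchPhi_eq_of_isLerchContinuation_lerchSlitPlane hF (hslit m' hm')] at h2
    refine tendsto_nhds_unique h1 (h2.congr fun N => Finset.sum_congr rfl fun n _ => ?_)
    rw [bilateralTerm_eq_rayIntegral ha (fun h => absurd h ha1) hm'0 ha2,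
      -- The wedge between `I` and the tilted direction at `L` lies in the open upper half-plane,
      -- because `L.im ≥ 0`.
      rayIntegral_rotate (d₂ := tiltedDir η p n) (by simpa using hm'0)
        (mul_tiltedDir_re_pos hη hηV hm' n) (fun u v hu hv huv => ?_) (Or.inl hL0)]
    rw [Complex.mem_slitPlane_iff]
    right
    simp only [Complex.add_im, Complex.im_ofReal_mul, Complex.I_im, tiltedDir_im, mul_one]
    have : 0 ≤ v * η := by positivity
    rcases hu.eq_or_lt with rfl | hu
    · have : 0 < v * η := mul_pos (by linarith) hη
      refine ne_of_gt ?_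
      linarith
    · refine ne_of_gt ?_
      linarith
  rw [neg_neg, lerchPhi_eq_of_isLerchContinuation_lerchSlitPlane hF (hslit m hm)]
  have h := tendsto_sum_tilted r hL hL0 hβ0 hβ1 hη hηV hm
  rwa [hS hm] at h

/-! ### The argument condition and the principal branch. -/

theorem mul_eq_norm_mul_exp_argUp (w L : ℂ) :
    w * L = ((‖w‖ * ‖L‖ : ℝ) : ℂ) * Complex.exp ((argUp w + L.arg : ℝ) * Complex.I) := by
  have h1 := Complex.norm_mul_exp_arg_mul_I (Complex.I * w)
  have h2 := Complex.norm_mul_exp_arg_mul_I L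
  rw [norm_mul, Complex.norm_I, one_mul] at h1
  have h3 : Complex.exp ((argUp w + L.arg : ℝ) * Complex.I) =
      Complex.exp ((Complex.I * w).arg * Complex.I) * Complex.exp (L.arg * Complex.I) *
        Complex.exp (-(Real.pi / 2 * Complex.I)) := by
    rw [← Complex.exp_add, ← Complex.exp_add, argUp]
    push_cast
    congr 1; ring
  rw [h3, Complex.exp_neg, Complex.exp_pi_div_two_mul_I, Complex.inv_I]
  push_cast
  calc w * L = (Complex.I * w) * L * -Complex.I := by linear_combination (w * L) * Complex.I_sq
    _ = (‖w‖ * Complex.exp ((Complex.I * w).arg * Complex.I)) *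
        (‖L‖ * Complex.exp (L.arg * Complex.I)) * -Complex.I := by rw [h1, h2]
    _ = _ := by ring

theorem mul_im_eq_sin_argUp (w L : ℂ) :
    (w * L).im = ‖w‖ * ‖L‖ * Real.sin (argUp w + L.arg) := by
  rw [mul_eq_norm_mul_exp_argUp, Complex.im_ofReal_mul, Complex.exp_ofReal_mul_I_im]

theorem mul_re_eq_cos_argUp (w L : ℂ) :
    (w * L).re = ‖w‖ * ‖L‖ * Real.cos (argUp w + L.arg) := by
  rw [mul_eq_norm_mul_exp_argUp, Complex.re_ofReal_mul, Complex.exp_ofReal_mul_I_re]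

theorem argUp_nonneg {w : ℂ} (hre : 0 < w.re) (him : 0 ≤ w.im) : 0 ≤ argUp w := by
  by_contra h
  rw [argUp, not_le] at h
  have h1 : 0 ≤ (Complex.I * w).arg := Complex.arg_nonneg_iff.2 (by simpa using hre.le)
  have h2 : |(Complex.I * w).arg| < Real.pi / 2 := by
    rw [abs_of_nonneg h1]; linarith
  rcases Complex.abs_arg_lt_pi_div_two_iff.1 h2 with h3 | h3
  · simp at h3
    linarith
  · have := congrArg Complex.im h3
    simp at this
    linarith

theorem argUp_le_neg_pi {w : ℂ} (hre : w.re < 0) (him : 0 ≤ w.im) : argUp w ≤ -Real.pi := by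
  by_contra h
  rw [argUp, not_le] at h
  have h1 : (Complex.I * w).arg < 0 := Complex.arg_neg_iff.2 (by simpa using hre)
  have h2 : |(Complex.I * w).arg| < Real.pi / 2 := by
    rw [abs_of_neg h1]; linarith
  rcases Complex.abs_arg_lt_pi_div_two_iff.1 h2 with h3 | h3
  · simp at h3
    linarith
  · have := congrArg Complex.im h3
    simp at this
    linarith

/-- As `n → -∞` the direction of `n - m` tends to `-1`, where `argUp` equals `-π`; pass to the limit
in the inequality. -/
theorem arg_nonneg_of_forall_argUp {m : ℂ} {θ : ℝ}
    (h : ∀ n : ℤ, -Real.pi < argUp ((n : ℂ) - m) + θ) : 0 ≤ θ := by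
  have h1 : Tendsto (fun N : ℕ => -Complex.I - Complex.I * m * ((N : ℝ)⁻¹ : ℝ)) atTop
      (𝓝 (-Complex.I - Complex.I * m * ((0 : ℝ) : ℂ))) := by
    refine Tendsto.const_sub _ (Tendsto.const_mul _ ?_)
    exact (Complex.continuous_ofReal.tendsto 0).comp tendsto_inv_atTop_nhds_zero_nat
  rw [Complex.ofReal_zero, mul_zero, sub_zero] at h1
  have h2 : Tendsto (fun N : ℕ => (-Complex.I - Complex.I * m * ((N : ℝ)⁻¹ : ℝ)).arg) atTop
      (𝓝 (-(Real.pi / 2))) := by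
    rw [← Complex.arg_neg_I]
    exact (Complex.continuousAt_arg (by simp [Complex.mem_slitPlane_iff])).tendsto.comp h1
  have h3 : -(Real.pi / 2) - Real.pi / 2 + θ ≥ -Real.pi := by
    refine ge_of_tendsto ((h2.sub_const (Real.pi / 2)).add_const θ) ?_
    filter_upwards [eventually_gt_atTop 0] with N hN
    have hN' : (0 : ℝ) < N := by exact_mod_cast hN
    have h4 := (h (-(N : ℤ))).le
    rw [argUp] at h4
    have hNc : (N : ℂ) ≠ 0 := by exact_mod_cast hN.ne'
    have h5 : Complex.I * (((-(N : ℤ) : ℤ) : ℂ) - m) =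
        ((N : ℝ) : ℂ) * (-Complex.I - Complex.I * m * ((N : ℝ)⁻¹ : ℝ)) := by
      push_cast
      field_simp
    rwa [h5, Complex.arg_real_mul _ hN'] at h4
  linarith

theorem im_nonneg_of_arg_log_nonneg {a : ℂ} (h : 0 ≤ (Complex.log a).arg) : 0 ≤ a.im := by
  rw [Complex.arg_nonneg_iff, Complex.log_im, Complex.arg_nonneg_iff] at h
  exact h

/-- For `p ≤ n` the sum of arguments lies in `[0, π]`, so `w * L` is in the closed upper half-plane
and both rays leave it upwards. For `n < p` the sum lies in `(-π, 0]` and the tilted ray goes down.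
In either case the wedge between the rays misses the cut. The integer exponent makes the scaling
free of branch conditions. -/
theorem upperIncompleteGamma_mul_eq_rayIntegral_tiltedDir {w L : ℂ} {η : ℝ} {p n : ℤ} (r : ℕ)
    (hL : 0 < L.arg) (hη : 0 < η) (hre : 0 < (w * tiltedDir η p n).re) (him : 0 ≤ w.im)
    (hp : p ≤ n → 0 < w.re) (hn : n < p → w.re < 0)
    (h1 : -Real.pi < argUp w + L.arg) (h2 : argUp w + L.arg ≤ Real.pi) :
    upperIncompleteGamma (1 + -(r : ℂ)) (w * L) =
      w ^ (-(r : ℂ) + 1) * rayIntegral (-(r : ℂ)) w L (tiltedDir η p n) := by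
  have hw0 : w ≠ 0 := by rintro rfl; simp at hre
  have hL0 : L ≠ 0 := by rintro rfl; simp at hL
  rw [upperIncompleteGamma_eq_rayIntegral, add_sub_cancel_left,
    rayIntegral_rotate (d₂ := w * tiltedDir η p n) (by simp [rayDir_re]) (by simpa using hre) ?_
      (Or.inl (mul_ne_zero hw0 hL0))]
  · refine rayIntegral_scale hw0 fun x _ => ?_
    simp only [Complex.cpow_neg, Complex.cpow_natCast, mul_pow, mul_inv]
  have hpos : 0 < ‖w‖ * ‖L‖ := mul_pos (norm_pos_iff.2 hw0) (norm_pos_iff.2 hL0)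
  intro a b ha hb hab
  rw [Complex.mem_slitPlane_iff]
  simp only [Complex.add_re, Complex.add_im, Complex.re_ofReal_mul, Complex.im_ofReal_mul]
  rcases le_or_gt p n with hpn | hpn
  · have hwr := hp hpn
    have him' : 0 < (w * tiltedDir η p n).im := by
      rw [tiltedDir, if_pos hpn]
      simp
      have := mul_pos hwr hη
      linarith
    have hz : 0 ≤ (w * L).im := by
      rw [mul_im_eq_sin_argUp]
      refine mul_nonneg hpos.le (Real.sin_nonneg_of_nonneg_of_le_pi ?_ h2)
      have := argUp_nonneg hwr him
      linarith
    right
    rw [rayDir, if_pos hz]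
    refine ne_of_gt ?_
    simp only [Complex.add_im, Complex.one_im, Complex.I_im, zero_add, mul_one]
    have := mul_nonneg hb him'.le
    rcases ha.eq_or_lt with rfl | ha
    · have := mul_pos (show 0 < b by linarith) him'
      linarith
    · linarith
  · have hwr := hn hpn
    have him' : (w * tiltedDir η p n).im < 0 := by
      rw [tiltedDir, if_neg (by omega)]
      simp
      have := mul_pos_of_neg_of_neg hwr (neg_lt_zero.2 hη)
      linarith
    have hle : argUp w + L.arg ≤ 0 := by
      have := argUp_le_neg_pi hwr him
      have := Complex.arg_le_pi L
      linarith
    -- If the sum is `0`, then `w * L > 0`: the two rays point to opposite sides of the real axis,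
    -- but the wedge stays in the right half-plane.
    rcases hle.eq_or_lt with h0 | h0
    · left
      rw [rayDir_re, mul_re_eq_cos_argUp, h0, Real.cos_zero]
      have := mul_nonneg hb hre.le
      linarith
    · have hz : (w * L).im < 0 := by
        rw [mul_im_eq_sin_argUp]
        exact mul_neg_of_pos_of_neg hpos (Real.sin_neg_of_neg_of_neg_pi_lt h0 h1)
      right
      rw [rayDir, if_neg (by linarith)]
      refine ne_of_lt ?_
      simp only [Complex.sub_im, Complex.one_im, Complex.I_im]
      have := mul_nonneg hb (neg_nonneg.2 him'.le)
      linarith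

theorem tendsto_sum_bilateralTerm_neg_natCast {a m : ℂ} {β : ℝ} {r : ℕ} (hr : r ≠ 0) (ha : a ≠ 0)
    (ha1 : a ≠ 1) (hβ0 : 0 < β) (hβ1 : β < 2 * Real.pi) (hm : m.im ≤ 0)
    (hmre : ∀ n : ℤ, m.re ≠ n)
    (harg : ∀ n : ℤ, -Real.pi < argUp ((n : ℂ) - m) + (Complex.log a).arg ∧
      argUp ((n : ℂ) - m) + (Complex.log a).arg ≤ Real.pi) :
    Tendsto (fun N : ℕ × ℕ => ∑ n ∈ Finset.Icc (-(N.1 : ℤ)) (N.2 : ℤ),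
      bilateralTerm a (-(r : ℂ)) m β n) atTop
      (𝓝 (Complex.I * Complex.exp (Complex.I * (-(r : ℂ) * Real.pi + 2 * m * β) / 2) *
        (2 * Real.pi : ℂ) ^ (1 + -(r : ℂ)) *
        lerchPhi (Complex.exp (2 * Complex.I * m * Real.pi)) (- -(r : ℂ))
          ((β - Complex.I * Complex.log a) / (2 * Real.pi)))) := by
  set p := ⌈m.re⌉ with hp
  have hp1 : m.re < p := lt_of_le_of_ne (Int.le_ceil _) (hmre p)
  have hp2 : (p : ℝ) - 1 < m.re := by
    have := Int.ceil_lt_add_one m.re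
    linarith
  have him : ∀ n : ℤ, 0 ≤ ((n : ℂ) - m).im := fun n => by simpa using hm
  have hlow : ∀ n : ℤ, n < p → ((n : ℂ) - m).re < 0 := fun n hn => by
    have : n ≤ p - 1 := by omega
    have : (n : ℝ) ≤ p - 1 := by exact_mod_cast this
    simp
    linarith
  have hupp : ∀ n : ℤ, p ≤ n → 0 < ((n : ℂ) - m).re := fun n hn => by
    have : (p : ℝ) ≤ n := by exact_mod_cast hn
    simp
    linarith
  -- The term `n = p - 1` has `argUp ≤ -π`, so the strict lower bound forces strict positivity; in
  -- particular `a.im ≥ 0`.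
  have hL : 0 < (Complex.log a).arg := by
    have h1 := argUp_le_neg_pi (hlow (p - 1) (by omega)) (him (p - 1))
    have h2 := (harg (p - 1)).1
    linarith
  -- Half the distance from `m.re` to the integers; with `V = 1 - m.im` and `η = δ / V` the point
  -- `m` lies in the truncated strip and `η * V = δ`.
  set δ := min (m.re - (p - 1)) (p - m.re) / 2 with hδ
  have hδ0 : 0 < δ := by
    have := lt_min (show 0 < m.re - (p - 1) by linarith) (show 0 < p - m.re by linarith)
    positivity
  have hδ1 : 2 * δ ≤ m.re - (p - 1) := by
    rw [hδ, mul_div_cancel₀ _ two_ne_zero]; exact min_le_left _ _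
  have hδ2 : 2 * δ ≤ p - m.re := by
    rw [hδ, mul_div_cancel₀ _ two_ne_zero]; exact min_le_right _ _
  have hV : 0 < 1 - m.im := by linarith
  have hη : 0 < δ / (1 - m.im) := by positivity
  have hηV : δ / (1 - m.im) * (1 - m.im) ≤ δ := by rw [div_mul_cancel₀ _ hV.ne']
  have hmem : m ∈ truncatedStrip p δ (1 - m.im) :=
    ⟨⟨by linarith, by linarith⟩, by linarith⟩
  refine (tendsto_sum_tilted_lerchPhi hr ha ha1 (im_nonneg_of_arg_log_nonneg hL.le) hβ0 hβ1 hη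
    hηV hδ0 hmem).congr fun N => Finset.sum_congr rfl fun n _ => ?_
  have hw0 : (n : ℂ) - m ≠ 0 := fun h0 => by
    have := congrArg Complex.re h0
    simp at this
    exact hmre n (by linarith)
  rw [bilateralTerm_eq ha, upperIncompleteGamma_mul_eq_rayIntegral_tiltedDir r hL hη
    (mul_tiltedDir_re_pos hη hηV hmem n) (him n) (hupp n) (hlow n) (harg n).1 (harg n).2]
  have : ((n : ℂ) - m) ^ (-(r : ℂ) + 1) ≠ 0 := (Complex.cpow_ne_zero_iff).2 (Or.inl hw0)
  field_simp

theorem theorem3p11 (a k m : ℂ) (β : ℝ) (ha : a ≠ 0)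
    (ha1 : a = 1 → -1 < k.re)
    (hβ0 : 0 < β) (hβ1 : β < 2 * Real.pi)
    (hm : ∀ n : ℤ, m ≠ n)
    (hbranch :
      -- arbitrary complex `k`
      (0 < m.im ∧ 0 ≤ a.im) ∨
      -- `k` a nonnegative integer
      (∃ j : ℕ, k = j) ∨
      -- `k` an integer
      ((∃ j : ℤ, k = j) ∧ (∀ n : ℤ, m.re = n → 0 < m.im) ∧
        ∀ n : ℤ, -Real.pi < argUp ((n : ℂ) - m) + (Complex.log a).arg ∧
          argUp ((n : ℂ) - m) + (Complex.log a).arg ≤ Real.pi)) :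
    Tendsto (fun N : ℕ × ℕ => ∑ n ∈ Finset.Icc (-(N.1 : ℤ)) (N.2 : ℤ), bilateralTerm a k m β n)
      atTop
      (𝓝 (Complex.I * Complex.exp (Complex.I * (k * Real.pi + 2 * m * β) / 2) *
        (2 * Real.pi : ℂ) ^ (1 + k) *
        lerchPhi (Complex.exp (2 * Complex.I * m * Real.pi)) (-k)
          ((β - Complex.I * Complex.log a) / (2 * Real.pi)))) := by
  rcases hbranch with ⟨hm0, ha2⟩ | ⟨j, rfl⟩ | ⟨⟨j, rfl⟩, hre, harg⟩
  · exact tendsto_sum_bilateralTerm_of_im_pos ha ha1 hβ0 hβ1 hm0 ha2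
  · exact tendsto_sum_bilateralTerm_natCast j ha hβ0 hβ1 hm
  rcases lt_or_ge j 0 with hj | hj
  · obtain ⟨r, rfl⟩ : ∃ r : ℕ, j = -(r : ℤ) := ⟨j.natAbs, by omega⟩
    rcases lt_or_ge 0 m.im with hm0 | hm0
    · exact tendsto_sum_bilateralTerm_of_im_pos ha ha1 hβ0 hβ1 hm0
        -- For `m.im > 0` the argument condition already gives `a.im ≥ 0`, so the Poisson case
        -- applies.
        (im_nonneg_of_arg_log_nonneg (arg_nonneg_of_forall_argUp fun n => (harg n).1))
    · have hr : r ≠ 0 := by rintro rfl; simp at hj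
      have ha1' : a ≠ 1 := fun h => by
        have h1 := ha1 h
        simp at h1
        exact hr h1
      push_cast
      exact tendsto_sum_bilateralTerm_neg_natCast hr ha ha1' hβ0 hβ1 hm0
        (fun n hn => absurd (hre n hn) (not_lt.2 hm0)) harg
  · lift j to ℕ using hj
    simpa using tendsto_sum_bilateralTerm_natCast j ha hβ0 hβ1 hm
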